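/- Let $\hbar>0$ and let $\lambda\neq 0$ be real. For $x_0,p_0\in\mathbb R$ let $(\mathcal D(x_0,p_0)\psi)(x)=e^{\frac{i}{\hbar}(p_0x-\frac12 p_0x_0)}\,\psi(x-x_0)$ be the displacement operator, and let $$\Pi_{\mathrm{BJ}}=\frac{1}{4\pi\hbar}\int_{\mathbb R^2}\operatorname{sinc}\!\Big(\frac{p_0x_0}{2\hbar}\Big)\,\mathcal D(x_0,p_0)\,dx_0\,dp_0,\qquad \operatorname{sinc}(a)=\frac{\sin a}{a},\ \operatorname{sinc}(0)=1,$$ be the Born-Jordan parity operator, the integral being understood weakly, i.e. $\langle\varphi|\Pi_{\mathrm{BJ}}|\psi\rangle=\frac{1}{4\pi\hbar}\int_{\mathbb R^2}\operatorname{sinc}\!\big(\frac{p_0x_0}{2\hbar}\big)\,\langle\varphi|\mathcal D(x_0,p_0)\psi\rangle\,dx_0\,dp_0$ for Schwartz functions $\varphi,\psi$ on $\mathbb R$, where $\langle f|g\rangle=\int_{\mathbb R}\overline{f(x)}\,g(x)\,dx$. Let $|n\rangle$, $n=0,1,2,\dots$, be the Fock (number) states of the harmonic oscillator: $|0\rangle$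 is the Gaussian $\big(\frac{\lambda^2}{\pi\hbar}\big)^{1/4}e^{-\lambda^2x^2/(2\hbar)}$ and $|n+1\rangle=(n+1)^{-1/2}\,\hat a_\lambda^\dagger|n\rangle$ with $\hat a_\lambda^\dagger=(\lambda\hat x-i\lambda^{-1}\hat p)/\sqrt{2\hbar}$, $\hat x\psi(x)=x\psi(x)$, $\hat p\psi=-i\hbar\,\psi'$. Then for every $n\in\{0,1,2,\dots\}$ the diagonal entry $[\Pi_{\mathrm{BJ}}]_{nn}:=\langle n|\Pi_{\mathrm{BJ}}|n\rangle$ is $$[\Pi_{\mathrm{BJ}}]_{nn}=\operatorname{arcsinh}(1)-\sqrt2\sum_{k=0}^{n-1}\frac{(-1)^k}{k+1}\sum_{m=0}^{\lfloor k/2\rfloor}\binom{2m}{m}\Big(\frac{-1}{4}\Big)^m .$$ In particular, $[\Pi_{\mathrm{BJ}}]_{nn}\to 0$ as $n\to\infty$. -/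

import Mathlib

open MeasureTheory Filter Topology SchwartzMap

noncomputable section

namespace BornJordan

/-- The phase-space displacement operator
`𝓓(x₀, p₀) ψ (x) = exp ((i / ħ) (p₀ x - p₀ x₀ / 2)) ψ (x - x₀)` in the coordinate representation. -/
def displacement (ħ x₀ p₀ : ℝ) (ψ : ℝ → ℂ) (x : ℝ) : ℂ :=
  Complex.exp (Complex.I / ħ * (p₀ * x - p₀ * x₀ / 2)) * ψ (x - x₀)

/-- The Born-Jordan filter function `K(x, p) = sinc (p x / (2 ħ))`, `sinc a = sin a / a`,
`sinc 0 = 1`. -/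
def filterFunction (ħ : ℝ) (Ω : ℝ × ℝ) : ℝ := Real.sinc (Ω.2 * Ω.1 / (2 * ħ))

/-- The bilinear pairing `∫ φ(x) (𝓓(x₀, p₀) ψ)(x) dx` with `Ω = (x₀, p₀)`. -/
def displacementPairing (ħ : ℝ) (φ ψ : ℝ → ℂ) (Ω : ℝ × ℝ) : ℂ :=
  ∫ x : ℝ, φ x * displacement ħ Ω.1 Ω.2 ψ x

/-! ### Absolute convergence of the phase-space integral on Schwartz functions -/

/-- A seminorm that controls the decay of order 4 of the first two derivatives. -/
def decaySeminorm : Seminorm ℂ 𝓢(ℝ, ℂ) :=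
  (Finset.Iic ((4, 2) : ℕ × ℕ)).sup (schwartzSeminormFamily ℂ ℝ ℂ)

lemma decay_iteratedDeriv (φ : 𝓢(ℝ, ℂ)) {i : ℕ} (hi : i ≤ 2) (x : ℝ) :
    (1 + |x|) ^ 4 * ‖iteratedDeriv i φ x‖ ≤ 16 * decaySeminorm φ := by
  have h := SchwartzMap.one_add_le_sup_seminorm_apply (𝕜 := ℂ) (m := (4, 2)) (k := 4) (n := i)
    le_rfl hi φ x
  rw [norm_iteratedFDeriv_eq_norm_iteratedDeriv] at h
  norm_num at h
  exact h

lemma norm_displacement (ħ x₀ p₀ : ℝ) (ψ : ℝ → ℂ) (x : ℝ) :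
    ‖displacement ħ x₀ p₀ ψ x‖ = ‖ψ (x - x₀)‖ := by
  have : Complex.I / ħ * (p₀ * x - p₀ * x₀ / 2)
      = ((1 / ħ * (p₀ * x - p₀ * x₀ / 2) : ℝ) : ℂ) * Complex.I := by
    push_cast; ring
  rw [displacement, norm_mul, this, Complex.norm_exp_ofReal_mul_I, one_mul]

lemma integrable_inv_one_add_abs_sq : Integrable fun x : ℝ ↦ ((1 + |x|) ^ 2)⁻¹ := by
  have h := integrable_one_add_norm (E := ℝ) (μ := volume) (r := 2) (by simp)
  refine h.congr (Eventually.of_forall fun x ↦ ?_)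
  simp only [Real.norm_eq_abs]
  rw [Real.rpow_neg (by positivity)]
  norm_num

lemma one_add_abs_le (x x₀ : ℝ) : 1 + |x₀| ≤ (1 + |x|) * (1 + |x - x₀|) := by
  have h1 : |x₀| ≤ |x| + |x - x₀| := by
    have := abs_sub x (x - x₀)
    simpa using this
  nlinarith [abs_nonneg x, abs_nonneg (x - x₀), mul_nonneg (abs_nonneg x) (abs_nonneg (x - x₀))]

lemma norm_integrand_le {A B : ℝ} (ħ : ℝ) (Ω : ℝ × ℝ) {φ ψ : ℝ → ℂ}
    (hφ : ∀ x, (1 + |x|) ^ 4 * ‖φ x‖ ≤ A) (hψ : ∀ x, (1 + |x|) ^ 4 * ‖ψ x‖ ≤ B) (x : ℝ) :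
    ‖φ x * displacement ħ Ω.1 Ω.2 ψ x‖
      ≤ A * B * ((1 + |Ω.1|) ^ 2)⁻¹ * ((1 + |x|) ^ 2)⁻¹ := by
  rw [norm_mul, norm_displacement]
  set a := 1 + |x| with ha
  set b := 1 + |x - Ω.1| with hb
  set c := 1 + |Ω.1| with hc
  have ha1 : 1 ≤ a := by simp [ha]
  have hb1 : 1 ≤ b := by simp [hb]
  have hc1 : 1 ≤ c := by simp [hc]
  have hcab : c ≤ a * b := one_add_abs_le x Ω.1
  have hA := hφ x
  have hB := hψ (x - Ω.1)
  rw [← ha] at hA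
  rw [← hb] at hB
  have hsq : c ^ 2 ≤ a ^ 2 * b ^ 2 := by
    rw [← mul_pow]; gcongr
  have hkey : a ^ 2 * c ^ 2 * (‖φ x‖ * ‖ψ (x - Ω.1)‖) ≤ A * B := by
    calc a ^ 2 * c ^ 2 * (‖φ x‖ * ‖ψ (x - Ω.1)‖)
        ≤ a ^ 2 * (a ^ 2 * b ^ 2) * (‖φ x‖ * ‖ψ (x - Ω.1)‖) := by gcongr
      _ ≤ a ^ 2 * (a ^ 2 * b ^ 4) * (‖φ x‖ * ‖ψ (x - Ω.1)‖) := by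
          gcongr
          norm_num
      _ = (a ^ 4 * ‖φ x‖) * (b ^ 4 * ‖ψ (x - Ω.1)‖) := by ring
      _ ≤ A * B := by
          gcongr
          exact le_trans (by positivity) hA
  have hpos : 0 < a ^ 2 * c ^ 2 := by positivity
  calc ‖φ x‖ * ‖ψ (x - Ω.1)‖ = (a ^ 2 * c ^ 2 * (‖φ x‖ * ‖ψ (x - Ω.1)‖)) / (a ^ 2 * c ^ 2) := by
        field_simp
    _ ≤ A * B / (a ^ 2 * c ^ 2) := by gcongr
    _ = A * B * (c ^ 2)⁻¹ * (a ^ 2)⁻¹ := by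
        field_simp

/-- The total mass of `(1 + |x|)⁻²`. -/
def decayMass : ℝ := ∫ x : ℝ, ((1 + |x|) ^ 2)⁻¹

lemma decayMass_nonneg : 0 ≤ decayMass := integral_nonneg fun x ↦ by positivity

lemma norm_displacementPairing_le {A B : ℝ} (ħ : ℝ) (Ω : ℝ × ℝ) {φ ψ : ℝ → ℂ}
    (hφ : ∀ x, (1 + |x|) ^ 4 * ‖φ x‖ ≤ A) (hψ : ∀ x, (1 + |x|) ^ 4 * ‖ψ x‖ ≤ B) :
    ‖displacementPairing ħ φ ψ Ω‖ ≤ A * B * ((1 + |Ω.1|) ^ 2)⁻¹ * decayMass := by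
  rw [decayMass, ← integral_const_mul]
  exact norm_integral_le_of_norm_le (integrable_inv_one_add_abs_sq.const_mul _)
    (Eventually.of_forall (norm_integrand_le ħ Ω hφ hψ))

lemma continuous_displacement {ψ : ℝ → ℂ} (hψ : Continuous ψ) (ħ : ℝ) :
    Continuous fun q : (ℝ × ℝ) × ℝ ↦ displacement ħ q.1.1 q.1.2 ψ q.2 := by
  unfold displacement
  fun_prop

lemma decay_zero (φ : 𝓢(ℝ, ℂ)) (x : ℝ) : (1 + |x|) ^ 4 * ‖φ x‖ ≤ 16 * decaySeminorm φ := by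
  simpa using decay_iteratedDeriv φ (i := 0) (by norm_num) x

lemma integrable_pairing (ħ : ℝ) (Ω : ℝ × ℝ) (φ ψ : 𝓢(ℝ, ℂ)) :
    Integrable fun x ↦ φ x * displacement ħ Ω.1 Ω.2 ψ x := by
  refine Integrable.mono' (integrable_inv_one_add_abs_sq.const_mul _) ?_
    (Eventually.of_forall (norm_integrand_le ħ Ω (decay_zero φ) (decay_zero ψ)))
  have := (continuous_displacement ψ.continuous ħ).comp
    (continuous_const.prodMk continuous_id : Continuous fun x : ℝ ↦ (Ω, x))
  exact (φ.continuous.mul this).aestronglyMeasurable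

/-- Integration by parts in the displacement pairing. -/
lemma momentum_mul_displacementPairing (ħ : ℝ) (Ω : ℝ × ℝ) (φ ψ : 𝓢(ℝ, ℂ)) :
    (Complex.I / ħ * Ω.2) * displacementPairing ħ φ ψ Ω
      = -(displacementPairing ħ (derivCLM ℂ ℂ φ) ψ Ω
          + displacementPairing ħ φ (derivCLM ℂ ℂ ψ) Ω) := by
  have hd : ∀ x, HasDerivAt (fun x ↦ φ x * displacement ħ Ω.1 Ω.2 ψ x)
      (derivCLM ℂ ℂ φ x * displacement ħ Ω.1 Ω.2 ψ x
        + (φ x * displacement ħ Ω.1 Ω.2 (derivCLM ℂ ℂ ψ) x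
          + (Complex.I / ħ * Ω.2) * (φ x * displacement ħ Ω.1 Ω.2 ψ x))) x := by
    intro x
    have h1 : HasDerivAt φ (derivCLM ℂ ℂ φ x) x := φ.hasDerivAt x
    have h2 : HasDerivAt (fun x : ℝ ↦ ψ (x - Ω.1)) (derivCLM ℂ ℂ ψ (x - Ω.1)) x := by
      simpa using (ψ.hasDerivAt (x - Ω.1)).comp_sub_const x Ω.1
    have h3 : HasDerivAt (fun x : ℝ ↦ Complex.I / ħ * (Ω.2 * (x : ℂ) - Ω.2 * Ω.1 / 2))
        (Complex.I / ħ * Ω.2) x := by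
      have := (((Complex.ofRealCLM.hasDerivAt (x := x)).const_mul (Ω.2 : ℂ)).sub_const
        ((Ω.2 : ℂ) * Ω.1 / 2)).const_mul (Complex.I / ħ)
      simpa using this
    have h := h1.mul (h3.cexp.mul h2)
    refine h.congr_deriv ?_
    simp only [displacement, Pi.mul_apply]
    ring
  have i1 := integrable_pairing ħ Ω (derivCLM ℂ ℂ φ) ψ
  have i2 := integrable_pairing ħ Ω φ (derivCLM ℂ ℂ ψ)
  have i3 := integrable_pairing ħ Ω φ ψ
  have i4 := i3.const_mul (Complex.I / ħ * Ω.2)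
  have i5 : Integrable fun x ↦ φ x * displacement ħ Ω.1 Ω.2 (derivCLM ℂ ℂ ψ) x
      + (Complex.I / ħ * Ω.2) * (φ x * displacement ħ Ω.1 Ω.2 ψ x) := i2.add i4
  have h0 := integral_eq_zero_of_hasDerivAt_of_integrable hd (i1.add i5) i3
  rw [integral_add i1 i5, integral_add i2 i4, integral_const_mul] at h0
  unfold displacementPairing
  linear_combination h0

/-- A bound by an integrable function, locally uniform in the two Schwartz functions. -/
lemma norm_displacementPairing_le_decay (ħ : ℝ) (φ ψ : 𝓢(ℝ, ℂ)) (Ω : ℝ × ℝ) :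
    ‖displacementPairing ħ φ ψ Ω‖ ≤
      1280 * decayMass * decaySeminorm φ * decaySeminorm ψ *
        (((1 + |Ω.1|) ^ 2)⁻¹ * (1 + (Ω.2 / ħ) ^ 2)⁻¹) := by
  set φ' := derivCLM ℂ ℂ φ
  set φ'' := derivCLM ℂ ℂ φ'
  set ψ' := derivCLM ℂ ℂ ψ
  set ψ'' := derivCLM ℂ ℂ ψ'
  have e1 : ∀ χ : 𝓢(ℝ, ℂ), ∀ x, (1 + |x|) ^ 4 * ‖derivCLM ℂ ℂ χ x‖ ≤ 16 * decaySeminorm χ := by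
    intro χ x
    simpa [iteratedDeriv_one] using decay_iteratedDeriv χ (i := 1) (by norm_num) x
  have e2 : ∀ χ : 𝓢(ℝ, ℂ), ∀ x,
      (1 + |x|) ^ 4 * ‖derivCLM ℂ ℂ (derivCLM ℂ ℂ χ) x‖ ≤ 16 * decaySeminorm χ := by
    intro χ x
    have h := decay_iteratedDeriv χ (i := 2) le_rfl x
    rw [iteratedDeriv_succ, iteratedDeriv_one] at h
    exact h
  set K := 256 * decayMass * decaySeminorm φ * decaySeminorm ψ * ((1 + |Ω.1|) ^ 2)⁻¹ with hK
  have hb : ∀ {f g : ℝ → ℂ}, (∀ x, (1 + |x|) ^ 4 * ‖f x‖ ≤ 16 * decaySeminorm φ) →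
      (∀ x, (1 + |x|) ^ 4 * ‖g x‖ ≤ 16 * decaySeminorm ψ) →
      ‖displacementPairing ħ f g Ω‖ ≤ K := by
    intro f g hf hg
    refine (norm_displacementPairing_le ħ Ω hf hg).trans (le_of_eq ?_)
    rw [hK]; ring
  have b0 := hb (decay_zero φ) (decay_zero ψ)
  have b1 : ‖displacementPairing ħ φ'' ψ Ω‖ ≤ K := hb (e2 φ) (decay_zero ψ)
  have b2 : ‖displacementPairing ħ φ' ψ' Ω‖ ≤ K := hb (e1 φ) (e1 ψ)
  have b3 : ‖displacementPairing ħ φ ψ'' Ω‖ ≤ K := hb (decay_zero φ) (e2 ψ)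
  have s0 := momentum_mul_displacementPairing ħ Ω φ ψ
  have s1 := momentum_mul_displacementPairing ħ Ω φ' ψ
  have s2 := momentum_mul_displacementPairing ħ Ω φ ψ'
  have hsq : (Complex.I / ħ * Ω.2) * (Complex.I / ħ * Ω.2) = -(((Ω.2 / ħ) ^ 2 : ℝ) : ℂ) := by
    push_cast
    linear_combination ((Ω.2 : ℂ) ^ 2 / (ħ : ℂ) ^ 2) * Complex.I_mul_I
  have key : (((Ω.2 / ħ) ^ 2 : ℝ) : ℂ) * displacementPairing ħ φ ψ Ω
      = -(displacementPairing ħ φ'' ψ Ω + 2 * displacementPairing ħ φ' ψ' Ω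
          + displacementPairing ħ φ ψ'' Ω) := by
    linear_combination (displacementPairing ħ φ ψ Ω) * hsq - (Complex.I / ħ * Ω.2) * s0 + s1 + s2
  have hn : (Ω.2 / ħ) ^ 2 * ‖displacementPairing ħ φ ψ Ω‖ ≤ 4 * K := by
    have h1 : ‖(((Ω.2 / ħ) ^ 2 : ℝ) : ℂ) * displacementPairing ħ φ ψ Ω‖
        = (Ω.2 / ħ) ^ 2 * ‖displacementPairing ħ φ ψ Ω‖ := by
      rw [norm_mul, Complex.norm_of_nonneg (sq_nonneg _)]
    rw [← h1, key, norm_neg]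
    refine (norm_add₃_le).trans ?_
    rw [norm_mul, Complex.norm_two]
    linarith
  have hpos : 0 < 1 + (Ω.2 / ħ) ^ 2 := by positivity
  have : ‖displacementPairing ħ φ ψ Ω‖ ≤ 5 * K * (1 + (Ω.2 / ħ) ^ 2)⁻¹ := by
    rw [← div_eq_mul_inv, le_div_iff₀ hpos]
    linarith
  refine this.trans (le_of_eq ?_)
  rw [hK]; ring

lemma integrable_decay {ħ : ℝ} (hħ : 0 < ħ) :
    Integrable fun Ω : ℝ × ℝ ↦ ((1 + |Ω.1|) ^ 2)⁻¹ * (1 + (Ω.2 / ħ) ^ 2)⁻¹ :=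
  integrable_inv_one_add_abs_sq.mul_prod (integrable_inv_one_add_sq.comp_div hħ.ne')

lemma abs_filter_le_one (ħ : ℝ) (Ω : ℝ × ℝ) : |filterFunction ħ Ω| ≤ 1 := Real.abs_sinc_le_one _

lemma norm_filtered_le (ħ : ℝ) (φ ψ : 𝓢(ℝ, ℂ)) (Ω : ℝ × ℝ) :
    ‖(filterFunction ħ Ω : ℂ) * displacementPairing ħ φ ψ Ω‖ ≤
      1280 * decayMass * decaySeminorm φ * decaySeminorm ψ *
        (((1 + |Ω.1|) ^ 2)⁻¹ * (1 + (Ω.2 / ħ) ^ 2)⁻¹) := by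
  rw [norm_mul, Complex.norm_real, Real.norm_eq_abs]
  refine le_trans ?_ (norm_displacementPairing_le_decay ħ φ ψ Ω)
  exact mul_le_of_le_one_left (norm_nonneg _) (abs_filter_le_one ħ Ω)

/-- The phase-space integral converges absolutely on Schwartz functions. -/
lemma integrable_filtered {ħ : ℝ} (hħ : 0 < ħ) (φ ψ : 𝓢(ℝ, ℂ)) :
    Integrable fun Ω : ℝ × ℝ ↦ (filterFunction ħ Ω : ℂ) * displacementPairing ħ φ ψ Ω := by
  refine Integrable.mono' ((integrable_decay hħ).const_mul _) ?_
    (Eventually.of_forall (norm_filtered_le ħ φ ψ))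
  have hc : Continuous fun Ω : ℝ × ℝ ↦ (filterFunction ħ Ω : ℂ) := by
    unfold filterFunction
    exact Complex.continuous_ofReal.comp (Real.continuous_sinc.comp (by fun_prop))
  have hm : StronglyMeasurable fun Ω : ℝ × ℝ ↦ displacementPairing ħ φ ψ Ω := by
    have : StronglyMeasurable fun q : (ℝ × ℝ) × ℝ ↦ φ q.2 * displacement ħ q.1.1 q.1.2 ψ q.2 :=
      ((φ.continuous.comp continuous_snd).mul
        (continuous_displacement ψ.continuous ħ)).stronglyMeasurable
    exact this.integral_prod_right
  exact hc.aestronglyMeasurable.mul hm.aestronglyMeasurable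

/-! ### The Born-Jordan parity operator -/

/-- The bilinear phase-space integral
`(4 π ħ)⁻¹ ∫ K(Ω) (∫ φ(x) (𝓓(Ω) ψ)(x) dx) dΩ`. -/
def parityPairing (ħ : ℝ) (φ ψ : 𝓢(ℝ, ℂ)) : ℂ :=
  ((4 * Real.pi * ħ)⁻¹ : ℝ) * ∫ Ω : ℝ × ℝ, (filterFunction ħ Ω : ℂ) * displacementPairing ħ φ ψ Ω

lemma displacementPairing_add_left (ħ : ℝ) (φ₁ φ₂ ψ : 𝓢(ℝ, ℂ)) (Ω : ℝ × ℝ) :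
    displacementPairing ħ (φ₁ + φ₂ : 𝓢(ℝ, ℂ)) ψ Ω
      = displacementPairing ħ φ₁ ψ Ω + displacementPairing ħ φ₂ ψ Ω := by
  unfold displacementPairing
  rw [← integral_add (integrable_pairing ħ Ω φ₁ ψ) (integrable_pairing ħ Ω φ₂ ψ)]
  simp [add_mul]

lemma displacementPairing_add_right (ħ : ℝ) (φ ψ₁ ψ₂ : 𝓢(ℝ, ℂ)) (Ω : ℝ × ℝ) :
    displacementPairing ħ φ (ψ₁ + ψ₂ : 𝓢(ℝ, ℂ)) Ω
      = displacementPairing ħ φ ψ₁ Ω + displacementPairing ħ φ ψ₂ Ω := by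
  unfold displacementPairing
  rw [← integral_add (integrable_pairing ħ Ω φ ψ₁) (integrable_pairing ħ Ω φ ψ₂)]
  simp [displacement, mul_add]

lemma displacementPairing_smul_left (ħ : ℝ) (c : ℂ) (φ ψ : 𝓢(ℝ, ℂ)) (Ω : ℝ × ℝ) :
    displacementPairing ħ (c • φ : 𝓢(ℝ, ℂ)) ψ Ω = c * displacementPairing ħ φ ψ Ω := by
  unfold displacementPairing
  rw [← integral_const_mul]
  simp [mul_assoc]

lemma displacementPairing_smul_right (ħ : ℝ) (c : ℂ) (φ ψ : 𝓢(ℝ, ℂ)) (Ω : ℝ × ℝ) :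
    displacementPairing ħ φ (c • ψ : 𝓢(ℝ, ℂ)) Ω = c * displacementPairing ħ φ ψ Ω := by
  unfold displacementPairing
  rw [← integral_const_mul]
  congr 1
  ext x
  simp [displacement]
  ring

lemma parityPairing_add_left {ħ : ℝ} (hħ : 0 < ħ) (φ₁ φ₂ ψ : 𝓢(ℝ, ℂ)) :
    parityPairing ħ (φ₁ + φ₂) ψ = parityPairing ħ φ₁ ψ + parityPairing ħ φ₂ ψ := by
  unfold parityPairing
  rw [← mul_add, ← integral_add (integrable_filtered hħ φ₁ ψ) (integrable_filtered hħ φ₂ ψ)]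
  simp only [displacementPairing_add_left, mul_add]

lemma parityPairing_add_right {ħ : ℝ} (hħ : 0 < ħ) (φ ψ₁ ψ₂ : 𝓢(ℝ, ℂ)) :
    parityPairing ħ φ (ψ₁ + ψ₂) = parityPairing ħ φ ψ₁ + parityPairing ħ φ ψ₂ := by
  unfold parityPairing
  rw [← mul_add, ← integral_add (integrable_filtered hħ φ ψ₁) (integrable_filtered hħ φ ψ₂)]
  simp only [displacementPairing_add_right, mul_add]

lemma parityPairing_smul_left (ħ : ℝ) (c : ℂ) (φ ψ : 𝓢(ℝ, ℂ)) :
    parityPairing ħ (c • φ) ψ = c * parityPairing ħ φ ψ := by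
  unfold parityPairing
  simp only [displacementPairing_smul_left, mul_left_comm _ c, integral_const_mul]

lemma parityPairing_smul_right (ħ : ℝ) (c : ℂ) (φ ψ : 𝓢(ℝ, ℂ)) :
    parityPairing ħ φ (c • ψ) = c * parityPairing ħ φ ψ := by
  unfold parityPairing
  simp only [displacementPairing_smul_right, mul_left_comm _ c, integral_const_mul]

lemma exists_norm_parityPairing_le {ħ : ℝ} (hħ : 0 < ħ) :
    ∃ C : ℝ, 0 ≤ C ∧ ∀ φ ψ : 𝓢(ℝ, ℂ),
      ‖parityPairing ħ φ ψ‖ ≤ C * decaySeminorm φ * decaySeminorm ψ := by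
  set J := ∫ Ω : ℝ × ℝ, ((1 + |Ω.1|) ^ 2)⁻¹ * (1 + (Ω.2 / ħ) ^ 2)⁻¹ with hJ
  have hJ0 : 0 ≤ J := integral_nonneg fun Ω ↦ by positivity
  have hM := decayMass_nonneg
  refine ⟨(4 * Real.pi * ħ)⁻¹ * (1280 * decayMass * J), by positivity, fun φ ψ ↦ ?_⟩
  have h := norm_integral_le_of_norm_le ((integrable_decay hħ).const_mul _)
    (Eventually.of_forall (norm_filtered_le ħ φ ψ))
  rw [integral_const_mul, ← hJ] at h
  rw [parityPairing, norm_mul, Complex.norm_of_nonneg (by positivity)]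
  calc (4 * Real.pi * ħ)⁻¹ * ‖∫ Ω : ℝ × ℝ, (filterFunction ħ Ω : ℂ) * displacementPairing ħ φ ψ Ω‖
      ≤ (4 * Real.pi * ħ)⁻¹ * (1280 * decayMass * decaySeminorm φ * decaySeminorm ψ * J) := by
        gcongr
    _ = _ := by ring

/-- The Born-Jordan parity operator `Π = (4 π ħ)⁻¹ ∫ K(Ω) 𝓓(Ω) dΩ` as a continuous linear
operator from Schwartz functions to tempered distributions; the operator-valued integral is
taken in the weak sense, i.e. after pairing with a test function. -/
def parity {ħ : ℝ} (hħ : 0 < ħ) : 𝓢(ℝ, ℂ) →L[ℂ] 𝓢'(ℝ, ℂ) where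
  toFun ψ := ContinuousLinearMap.toPointwiseConvergenceCLM _ _ _ _
    (SchwartzMap.mkCLMtoNormedSpace (σ := RingHom.id ℂ) (fun φ ↦ parityPairing ħ φ ψ)
      (fun φ₁ φ₂ ↦ parityPairing_add_left hħ φ₁ φ₂ ψ)
      (fun c φ ↦ parityPairing_smul_left ħ c φ ψ)
      (by
        obtain ⟨C, hC, h⟩ := exists_norm_parityPairing_le hħ
        refine ⟨Finset.Iic (4, 2), C * decaySeminorm ψ, by positivity, fun φ ↦ (h φ ψ).trans ?_⟩
        exact le_of_eq (mul_right_comm _ _ _)))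
  map_add' ψ₁ ψ₂ := by
    ext φ
    exact parityPairing_add_right hħ φ ψ₁ ψ₂
  map_smul' c ψ := by
    ext φ
    exact parityPairing_smul_right ħ c φ ψ
  cont := PointwiseConvergenceCLM.continuous_of_continuous_eval fun φ ↦
    (SchwartzMap.mkCLMtoNormedSpace (σ := RingHom.id ℂ) (fun ψ ↦ parityPairing ħ φ ψ)
      (fun ψ₁ ψ₂ ↦ parityPairing_add_right hħ φ ψ₁ ψ₂)
      (fun c ψ ↦ parityPairing_smul_right ħ c φ ψ)
      (by
        obtain ⟨C, hC, h⟩ := exists_norm_parityPairing_le hħ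
        exact ⟨Finset.Iic (4, 2), C * decaySeminorm φ, by positivity, fun ψ ↦ h φ ψ⟩)).cont

lemma parity_apply {ħ : ℝ} (hħ : 0 < ħ) (φ ψ : 𝓢(ℝ, ℂ)) :
    parity hħ ψ φ = ((4 * Real.pi * ħ)⁻¹ : ℝ) *
      ∫ Ω : ℝ × ℝ, (filterFunction ħ Ω : ℂ) * ∫ x : ℝ, φ x * displacement ħ Ω.1 Ω.2 ψ x :=
  rfl

/-- Complex conjugation of Schwartz functions. -/
def conj (φ : 𝓢(ℝ, ℂ)) : 𝓢(ℝ, ℂ) :=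
  SchwartzMap.postcompCLM (𝕜 := ℝ) (Complex.conjCLE : ℂ →L[ℝ] ℂ) φ

lemma conj_apply (φ : 𝓢(ℝ, ℂ)) (x : ℝ) : conj φ x = starRingEnd ℂ (φ x) := rfl

/-- The sesquilinear matrix element `⟨φ| T |ψ⟩` of an operator `T : 𝓢 → 𝓢'`
(antilinear in `φ`). -/
def matrixElement (T : 𝓢(ℝ, ℂ) →L[ℂ] 𝓢'(ℝ, ℂ)) (φ ψ : 𝓢(ℝ, ℂ)) : ℂ := T ψ (conj φ)

/-! ### The Fock basis -/

/-- The position operator. -/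
def position : 𝓢(ℝ, ℂ) →L[ℂ] 𝓢(ℝ, ℂ) := SchwartzMap.smulLeftCLM ℂ (fun x : ℝ ↦ (x : ℂ))

lemma position_apply (ψ : 𝓢(ℝ, ℂ)) (x : ℝ) : position ψ x = x * ψ x :=
  SchwartzMap.smulLeftCLM_apply_apply Complex.ofRealCLM.hasTemperateGrowth ψ x

/-- The momentum operator `-i ħ d/dx`. -/
def momentum (ħ : ℝ) : 𝓢(ℝ, ℂ) →L[ℂ] 𝓢(ℝ, ℂ) := (-Complex.I * ħ) • derivCLM ℂ ℂ

/-- The raising operator `(l x - i l⁻¹ p) / √(2 ħ)` of the harmonic oscillator with scaling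
parameter `l`. -/
def raising (ħ l : ℝ) : 𝓢(ℝ, ℂ) →L[ℂ] 𝓢(ℝ, ℂ) :=
  ((√(2 * ħ))⁻¹ : ℂ) • ((l : ℂ) • position - (Complex.I * (l : ℂ)⁻¹) • momentum ħ)

lemma exists_polynomial_iteratedDeriv_gaussian (b : ℝ) (n : ℕ) :
    ∃ P : Polynomial ℝ, ∀ x : ℝ,
      iteratedDeriv n (fun x : ℝ ↦ Real.exp (-b * x ^ 2)) x = P.eval x * Real.exp (-b * x ^ 2) := by
  induction n with
  | zero => exact ⟨1, fun x ↦ by simp⟩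
  | succ n ih =>
    obtain ⟨P, hP⟩ := ih
    refine ⟨P.derivative - Polynomial.C (2 * b) * Polynomial.X * P, fun x ↦ ?_⟩
    rw [iteratedDeriv_succ, funext hP]
    have h1 : HasDerivAt (fun x : ℝ ↦ -b * x ^ 2) (-b * (2 * x)) x := by
      simpa using (hasDerivAt_pow 2 x).const_mul (-b)
    have h2 : HasDerivAt (fun x : ℝ ↦ P.eval x * Real.exp (-b * x ^ 2)) _ x :=
      (P.hasDerivAt x).mul h1.exp
    rw [h2.deriv]
    simp
    ring

lemma exists_bound_polynomial_mul_gaussian {b : ℝ} (hb : 0 < b) (P : Polynomial ℝ) :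
    ∃ C : ℝ, ∀ x : ℝ, |P.eval x * Real.exp (-b * x ^ 2)| ≤ C := by
  induction P using Polynomial.induction_on' with
  | add P Q hP hQ =>
    obtain ⟨C, hC⟩ := hP
    obtain ⟨D, hD⟩ := hQ
    refine ⟨C + D, fun x ↦ ?_⟩
    rw [Polynomial.eval_add, add_mul]
    exact (abs_add_le _ _).trans (add_le_add (hC x) (hD x))
  | monomial n a =>
    have ht := tendsto_rpow_abs_mul_exp_neg_mul_sq_cocompact hb n
    have hc : Continuous fun x : ℝ ↦ |x| ^ (n : ℝ) * Real.exp (-b * x ^ 2) := by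
      simp only [Real.rpow_natCast]
      fun_prop
    obtain ⟨C, hC⟩ := (ZeroAtInftyContinuousMap.isBounded_range
      (⟨⟨_, hc⟩, ht⟩ : ZeroAtInftyContinuousMap ℝ ℝ)).exists_norm_le
    refine ⟨|a| * C, fun x ↦ ?_⟩
    have : |(|x| ^ (n : ℝ) * Real.exp (-b * x ^ 2))| ≤ C := hC _ ⟨x, rfl⟩
    rw [Real.rpow_natCast] at this
    rw [Polynomial.eval_monomial, mul_assoc, abs_mul, abs_mul, abs_pow]
    rw [abs_mul, abs_pow, abs_abs] at this
    gcongr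

/-- The Gaussian `exp (-b x²)` as a real Schwartz function. -/
def gaussian {b : ℝ} (hb : 0 < b) : 𝓢(ℝ, ℝ) where
  toFun x := Real.exp (-b * x ^ 2)
  smooth' := by fun_prop
  decay' k n := by
    obtain ⟨P, hP⟩ := exists_polynomial_iteratedDeriv_gaussian b n
    obtain ⟨C, hC⟩ := exists_bound_polynomial_mul_gaussian hb (Polynomial.X ^ k * P)
    refine ⟨C, fun x ↦ ?_⟩
    rw [norm_iteratedFDeriv_eq_norm_iteratedDeriv, hP]
    have := hC x
    rw [Polynomial.eval_mul, Polynomial.eval_pow, Polynomial.eval_X, mul_assoc, abs_mul,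
      abs_pow] at this
    simpa using this

lemma vacuum_rate_pos {ħ l : ℝ} (hħ : 0 < ħ) (hl : l ≠ 0) : 0 < l ^ 2 / (2 * ħ) := by
  positivity

/-- The harmonic-oscillator ground state `(l² / (π ħ))^(1/4) exp (-l² x² / (2 ħ))`. -/
def vacuum {ħ l : ℝ} (hħ : 0 < ħ) (hl : l ≠ 0) : 𝓢(ℝ, ℂ) :=
  (((l ^ 2 / (Real.pi * ħ)) ^ (1 / 4 : ℝ) : ℝ) : ℂ) •
    SchwartzMap.postcompCLM (𝕜 := ℝ) Complex.ofRealCLM (gaussian (vacuum_rate_pos hħ hl))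

lemma vacuum_apply {ħ l : ℝ} (hħ : 0 < ħ) (hl : l ≠ 0) (x : ℝ) :
    vacuum hħ hl x =
      (((l ^ 2 / (Real.pi * ħ)) ^ (1 / 4 : ℝ) * Real.exp (-(l ^ 2 / (2 * ħ)) * x ^ 2) : ℝ) : ℂ) := by
  rw [Complex.ofReal_mul]
  rfl

/-- The Fock (number) states: `|0⟩` is the ground state and
`|n + 1⟩ = (n + 1)^(-1/2) a† |n⟩`. -/
def fock {ħ l : ℝ} (hħ : 0 < ħ) (hl : l ≠ 0) : ℕ → 𝓢(ℝ, ℂ)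
  | 0 => vacuum hħ hl
  | n + 1 => ((√((n : ℝ) + 1))⁻¹ : ℂ) • raising ħ l (fock hħ hl n)

/-- The matrix elements `⟨m| Π |n⟩` of the Born-Jordan parity operator in the Fock basis. -/
def parityEntry {ħ l : ℝ} (hħ : 0 < ħ) (hl : l ≠ 0) (m n : ℕ) : ℂ :=
  matrixElement (parity hħ) (fock hħ hl m) (fock hħ hl n)

end BornJordan

end

/-! The sequence of diagonal entries is found through its generating function. By the ladder
operators, `⟨n|𝓓(Ω)|n⟩ = exp (-s/2) Lₙ(s)`, where `Lₙ` is the Laguerre polynomial and `s` is the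
squared modulus of the coherent amplitude of `Ω` (`displacementPairing_fock`). Summing `Lₙ(s) tⁿ`
turns this into `(1 - t)⁻¹ exp (-c s/2)` with `c = (1 + t)/(1 - t)`, a pure Gaussian on phase space.
Writing `sinc` as an average of cosines makes its Gaussian average elementary, with value `arsinh
(1/c)` (`integral_filterFunction_mul_exp`). Hence, for small `t`, `∑ Πₙₙ tⁿ = (1 - t)⁻¹ arsinh ((1 -
t)/(1 + t))`.

The factor `(1 - t)⁻¹` forms partial sums, so `Πₙₙ` is the sum of the Taylor coefficients of `arsinh
((1 - t)/(1 + t))` up to order `n`. These come from integrating the derivative `-√2 / ((1 + t) √(1 +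
t²))` termwise (`hasSum_arsinhCoeff`).

For the limit, the coefficient series converges by Dirichlet's test, and Abel's theorem identifies
its sum with the boundary value `arsinh 0 = 0` at `t = 1` (`tendsto_sum_arsinhCoeff`). -/

noncomputable section

namespace BornJordan

/-! ### Ladder operators and the displacement pairing -/

/-- The lowering operator `(l x + i l⁻¹ p) / √(2 ħ)` of the harmonic oscillator. -/
def lowering (ħ l : ℝ) : 𝓢(ℝ, ℂ) →L[ℂ] 𝓢(ℝ, ℂ) :=
  ((√(2 * ħ) : ℝ) : ℂ)⁻¹ • ((l : ℂ) • position + (Complex.I * (l : ℂ)⁻¹) • momentum ħ)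

/-- The complex phase-space coordinate `(l x₀ + i l⁻¹ p₀) / √(2 ħ)`. -/
def coherentAmplitude (ħ l : ℝ) (Ω : ℝ × ℝ) : ℂ :=
  ((√(2 * ħ) : ℝ) : ℂ)⁻¹ * (l * Ω.1 + Complex.I * (l : ℂ)⁻¹ * Ω.2)

/-- The squared modulus of the complex phase-space coordinate. -/
def excitation (ħ l : ℝ) (Ω : ℝ × ℝ) : ℝ := (l ^ 2 * Ω.1 ^ 2 + Ω.2 ^ 2 / l ^ 2) / (2 * ħ)

lemma inv_sqrt_mul_inv_sqrt {ħ : ℝ} (hħ : 0 < ħ) :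
    ((√(2 * ħ) : ℝ) : ℂ)⁻¹ * ((√(2 * ħ) : ℝ) : ℂ)⁻¹ = (2 * ħ : ℂ)⁻¹ := by
  rw [← mul_inv, ← Complex.ofReal_mul, Real.mul_self_sqrt (by positivity)]
  push_cast; rfl

lemma coherentAmplitude_mul_conj {ħ : ℝ} (hħ : 0 < ħ) (l : ℝ) (Ω : ℝ × ℝ) :
    coherentAmplitude ħ l Ω * starRingEnd ℂ (coherentAmplitude ħ l Ω) = excitation ħ l Ω := by
  have h := inv_sqrt_mul_inv_sqrt hħ
  simp only [coherentAmplitude, excitation, map_mul, map_add, map_inv₀, Complex.conj_ofReal,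
    Complex.conj_I]
  push_cast
  linear_combination (l * Ω.1 + Complex.I * (l : ℂ)⁻¹ * Ω.2) *
    (l * Ω.1 - Complex.I * (l : ℂ)⁻¹ * Ω.2) * h - (2 * ħ : ℂ)⁻¹ * (l : ℂ)⁻¹ ^ 2 * Ω.2 ^ 2 *
    Complex.I_mul_I

/-- The two factors of `i` cancel, leaving a differential operator with real coefficients. Position
is symmetric and the derivative antisymmetric under the bilinear pairing, so raising and lowering
are transposes of each other. -/
lemma raising_apply (ħ l : ℝ) (ψ : 𝓢(ℝ, ℂ)) :
    raising ħ l ψ = (((√(2 * ħ) : ℝ) : ℂ)⁻¹ * l) • position ψ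
      + (-(((√(2 * ħ) : ℝ) : ℂ)⁻¹ * (ħ * (l : ℂ)⁻¹))) • derivCLM ℂ ℂ ψ := by
  ext x
  simp only [raising, momentum, smul_apply, sub_apply, add_apply, smul_eq_mul,
    derivCLM_apply]
  linear_combination ((√(2 * ħ) : ℝ) : ℂ)⁻¹ * ħ * (l : ℂ)⁻¹ * deriv ψ x * Complex.I_mul_I

lemma lowering_apply (ħ l : ℝ) (ψ : 𝓢(ℝ, ℂ)) :
    lowering ħ l ψ = (((√(2 * ħ) : ℝ) : ℂ)⁻¹ * l) • position ψ
      + (((√(2 * ħ) : ℝ) : ℂ)⁻¹ * (ħ * (l : ℂ)⁻¹)) • derivCLM ℂ ℂ ψ := by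
  ext x
  simp only [lowering, momentum, smul_apply, add_apply, smul_eq_mul, derivCLM_apply]
  linear_combination -((√(2 * ħ) : ℝ) : ℂ)⁻¹ * ħ * (l : ℂ)⁻¹ * deriv ψ x * Complex.I_mul_I

lemma displacementPairing_position (ħ : ℝ) (φ ψ : 𝓢(ℝ, ℂ)) (Ω : ℝ × ℝ) :
    displacementPairing ħ (position φ) ψ Ω
      = displacementPairing ħ φ (position ψ) Ω + Ω.1 * displacementPairing ħ φ ψ Ω := by
  unfold displacementPairing
  rw [← integral_const_mul, ← integral_add (integrable_pairing ħ Ω φ (position ψ))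
    ((integrable_pairing ħ Ω φ ψ).const_mul _)]
  congr 1
  ext x
  simp only [displacement, position_apply]
  push_cast
  ring

/-- The transpose of `a†` is `a`, and `a 𝓓 = 𝓓 (a + α)` with `α` the coherent amplitude. -/
lemma displacementPairing_raising_left {ħ : ℝ} (hħ : 0 < ħ) (l : ℝ) (φ ψ : 𝓢(ℝ, ℂ))
    (Ω : ℝ × ℝ) :
    displacementPairing ħ (raising ħ l φ) ψ Ω = displacementPairing ħ φ (lowering ħ l ψ) Ω
      + coherentAmplitude ħ l Ω * displacementPairing ħ φ ψ Ω := by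
  have h0 : (ħ : ℂ) ≠ 0 := by exact_mod_cast hħ.ne'
  have h1 := momentum_mul_displacementPairing ħ Ω φ ψ
  have h2 := displacementPairing_position ħ φ ψ Ω
  rw [raising_apply, lowering_apply, displacementPairing_add_left, displacementPairing_add_right]
  simp only [displacementPairing_smul_left, displacementPairing_smul_right, coherentAmplitude]
  have h3 : Complex.I * Ω.2 * displacementPairing ħ φ ψ Ω
      = -ħ * (displacementPairing ħ (derivCLM ℂ ℂ φ) ψ Ω
          + displacementPairing ħ φ (derivCLM ℂ ℂ ψ) Ω) := by
    rw [neg_mul, ← mul_neg, ← h1]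
    field_simp
  linear_combination ((√(2 * ħ) : ℝ) : ℂ)⁻¹ * l * h2 - ((√(2 * ħ) : ℝ) : ℂ)⁻¹ * (l : ℂ)⁻¹ * h3

/-- The companion relation: `𝓓 a† = (a† - conj α) 𝓓`, followed by transposition. -/
lemma displacementPairing_raising_right {ħ : ℝ} (hħ : 0 < ħ) (l : ℝ) (φ ψ : 𝓢(ℝ, ℂ))
    (Ω : ℝ × ℝ) :
    displacementPairing ħ φ (raising ħ l ψ) Ω = displacementPairing ħ (lowering ħ l φ) ψ Ω
      - starRingEnd ℂ (coherentAmplitude ħ l Ω) * displacementPairing ħ φ ψ Ω := by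
  have h0 : (ħ : ℂ) ≠ 0 := by exact_mod_cast hħ.ne'
  have h1 := momentum_mul_displacementPairing ħ Ω φ ψ
  have h2 := displacementPairing_position ħ φ ψ Ω
  rw [raising_apply, lowering_apply, displacementPairing_add_left, displacementPairing_add_right]
  simp only [displacementPairing_smul_left, displacementPairing_smul_right, coherentAmplitude,
    map_mul, map_add, map_inv₀, Complex.conj_ofReal, Complex.conj_I]
  have h3 : Complex.I * Ω.2 * displacementPairing ħ φ ψ Ω
      = -ħ * (displacementPairing ħ (derivCLM ℂ ℂ φ) ψ Ω
          + displacementPairing ħ φ (derivCLM ℂ ℂ ψ) Ω) := by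
    rw [neg_mul, ← mul_neg, ← h1]
    field_simp
  linear_combination -((√(2 * ħ) : ℝ) : ℂ)⁻¹ * l * h2 - ((√(2 * ħ) : ℝ) : ℂ)⁻¹ * (l : ℂ)⁻¹ * h3

/-! ### Unnormalised number states -/

/-- The unnormalised number states `(a†)ⁿ |0⟩`. -/
def ladderState {ħ l : ℝ} (hħ : 0 < ħ) (hl : l ≠ 0) : ℕ → 𝓢(ℝ, ℂ)
  | 0 => vacuum hħ hl
  | n + 1 => raising ħ l (ladderState hħ hl n)

lemma fock_eq_smul_ladderState {ħ l : ℝ} (hħ : 0 < ħ) (hl : l ≠ 0) (n : ℕ) :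
    fock hħ hl n = ((√(n.factorial : ℝ) : ℝ) : ℂ)⁻¹ • ladderState hħ hl n := by
  induction n with
  | zero => simp [fock, ladderState]
  | succ n ih =>
    rw [fock, ih, ladderState, map_smul, smul_smul, Nat.factorial_succ, Nat.cast_mul,
      Real.sqrt_mul (by positivity)]
    push_cast
    rw [mul_inv]

lemma deriv_position (ψ : 𝓢(ℝ, ℂ)) :
    derivCLM ℂ ℂ (position ψ) = ψ + position (derivCLM ℂ ℂ ψ) := by
  ext x
  have h : HasDerivAt (fun x : ℝ ↦ (x : ℂ) * ψ x) (1 * ψ x + x * deriv ψ x) x :=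
    (Complex.ofRealCLM.hasDerivAt (x := x)).mul (ψ.hasDerivAt x)
  have h2 : ⇑(position ψ) = fun x : ℝ ↦ (x : ℂ) * ψ x := funext (position_apply ψ)
  simp only [derivCLM_apply, add_apply, position_apply]
  rw [h2, h.deriv, one_mul]

lemma lowering_raising {ħ l : ℝ} (hħ : 0 < ħ) (hl : l ≠ 0) (ψ : 𝓢(ℝ, ℂ)) :
    lowering ħ l (raising ħ l ψ) = raising ħ l (lowering ħ l ψ) + ψ := by
  have h := inv_sqrt_mul_inv_sqrt hħ
  have hħ' : (ħ : ℂ) ≠ 0 := by exact_mod_cast hħ.ne'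
  have hl' : (l : ℂ) ≠ 0 := by exact_mod_cast hl
  have e : (2 * ħ : ℂ)⁻¹ * (2 * ħ) * (l * (l : ℂ)⁻¹) = 1 := by field_simp
  simp only [raising_apply, lowering_apply, map_add, map_smul, deriv_position]
  ext x
  simp only [add_apply, smul_apply, smul_eq_mul]
  linear_combination (2 * ħ) * (l * (l : ℂ)⁻¹) * ψ x * h + ψ x * e

lemma lowering_vacuum {ħ l : ℝ} (hħ : 0 < ħ) (hl : l ≠ 0) :
    lowering ħ l (vacuum hħ hl) = 0 := by
  have hħ' : (ħ : ℂ) ≠ 0 := by exact_mod_cast hħ.ne'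
  have hl' : (l : ℂ) ≠ 0 := by exact_mod_cast hl
  ext x
  have h1 : HasDerivAt (fun x : ℝ ↦ -(l ^ 2 / (2 * ħ)) * x ^ 2) (-(l ^ 2 / (2 * ħ)) * (2 * x)) x := by
    simpa using (hasDerivAt_pow 2 x).const_mul (-(l ^ 2 / (2 * ħ)))
  have h2 := (h1.exp.const_mul ((l ^ 2 / (Real.pi * ħ)) ^ (1 / 4 : ℝ))).ofReal_comp
  rw [← funext (vacuum_apply hħ hl)] at h2
  rw [lowering_apply]
  simp only [add_apply, smul_apply, smul_eq_mul, position_apply, derivCLM_apply, h2.deriv,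
    vacuum_apply, zero_apply]
  push_cast
  field_simp
  ring

lemma lowering_ladderState_succ {ħ l : ℝ} (hħ : 0 < ħ) (hl : l ≠ 0) (n : ℕ) :
    lowering ħ l (ladderState hħ hl (n + 1)) = ((n : ℂ) + 1) • ladderState hħ hl n := by
  induction n with
  | zero => simp [ladderState, lowering_raising hħ hl, lowering_vacuum]
  | succ n ih =>
    rw [ladderState, lowering_raising hħ hl, ih, map_smul, ← ladderState]
    ext x
    simp only [add_apply, smul_apply, smul_eq_mul]
    push_cast
    ring

/-- The vacuum is real and `a†` has real coefficients. Reality of the states lets the sesquilinear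
matrix element be computed with the bilinear pairing. -/
lemma conj_ladderState {ħ l : ℝ} (hħ : 0 < ħ) (hl : l ≠ 0) (n : ℕ) :
    conj (ladderState hħ hl n) = ladderState hħ hl n := by
  induction n with
  | zero =>
    ext x
    rw [conj_apply, ladderState, vacuum_apply, Complex.conj_ofReal]
  | succ n ih =>
    ext x
    have hd : starRingEnd ℂ (deriv (ladderState hħ hl n) x) = deriv (ladderState hħ hl n) x := by
      have h1 := ((ladderState hħ hl n).hasDerivAt x).star
      have h2 : (fun x ↦ star (ladderState hħ hl n x)) = ladderState hħ hl n := by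
        ext y
        exact DFunLike.congr_fun ih y
      rw [h2] at h1
      exact h1.deriv.symm
    have hx : starRingEnd ℂ (ladderState hħ hl n x) = ladderState hħ hl n x :=
      DFunLike.congr_fun ih x
    rw [conj_apply, ladderState, raising_apply]
    simp [position_apply, hd, hx]

lemma conj_fock {ħ l : ℝ} (hħ : 0 < ħ) (hl : l ≠ 0) (n : ℕ) :
    conj (fock hħ hl n) = fock hħ hl n := by
  ext x
  have hx : starRingEnd ℂ (ladderState hħ hl n x) = ladderState hħ hl n x :=
    DFunLike.congr_fun (conj_ladderState hħ hl n) x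
  rw [conj_apply, fock_eq_smul_ladderState]
  simp [hx]

/-- Completing the square in `x` produces a phase `i x₀ p₀ / (2ħ)`, which the symmetric phase `-p₀
x₀ / 2` in the displacement cancels; the overlap is therefore real. -/
lemma displacementPairing_vacuum {ħ l : ℝ} (hħ : 0 < ħ) (hl : l ≠ 0) (Ω : ℝ × ℝ) :
    displacementPairing ħ (vacuum hħ hl) (vacuum hħ hl) Ω
      = Real.exp (-excitation ħ l Ω / 2) := by
  have hħ' : (ħ : ℂ) ≠ 0 := by exact_mod_cast hħ.ne'
  have hl' : (l : ℂ) ≠ 0 := by exact_mod_cast hl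
  have hb : 0 < l ^ 2 / ħ := by positivity
  have hc : ((l ^ 2 / (Real.pi * ħ)) ^ (1 / 4 : ℝ)) * ((l ^ 2 / (Real.pi * ħ)) ^ (1 / 4 : ℝ))
      = (l ^ 2 / (Real.pi * ħ)) ^ (1 / 2 : ℝ) := by
    rw [← Real.rpow_add (by positivity)]; norm_num
  have hint := integral_cexp_quadratic (b := ((-(l ^ 2 / ħ) : ℝ) : ℂ))
    (by rw [Complex.ofReal_re]; linarith) (l ^ 2 * Ω.1 / ħ + Complex.I * Ω.2 / ħ)
    (-(l ^ 2 * Ω.1 ^ 2 / (2 * ħ)) - Complex.I * Ω.2 * Ω.1 / (2 * ħ))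
  have e : ∀ x : ℝ, vacuum hħ hl x * displacement ħ Ω.1 Ω.2 (vacuum hħ hl) x
      = (((l ^ 2 / (Real.pi * ħ)) ^ (1 / 2 : ℝ) : ℝ) : ℂ) *
        Complex.exp (((-(l ^ 2 / ħ) : ℝ) : ℂ) * x ^ 2
          + (l ^ 2 * Ω.1 / ħ + Complex.I * Ω.2 / ħ) * x
          + (-(l ^ 2 * Ω.1 ^ 2 / (2 * ħ)) - Complex.I * Ω.2 * Ω.1 / (2 * ħ))) := by
    intro x
    rw [displacement, vacuum_apply, vacuum_apply, ← hc]
    simp only [Complex.ofReal_mul, Complex.ofReal_exp]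
    have : ((-(l ^ 2 / ħ) : ℝ) : ℂ) * x ^ 2
          + (l ^ 2 * Ω.1 / ħ + Complex.I * Ω.2 / ħ) * x
          + (-(l ^ 2 * Ω.1 ^ 2 / (2 * ħ)) - Complex.I * Ω.2 * Ω.1 / (2 * ħ))
        = ((-(l ^ 2 / (2 * ħ)) * x ^ 2 : ℝ) : ℂ) + Complex.I / ħ * (Ω.2 * x - Ω.2 * Ω.1 / 2)
          + ((-(l ^ 2 / (2 * ħ)) * (x - Ω.1) ^ 2 : ℝ) : ℂ) := by
      push_cast
      field_simp
      ring
    rw [this, Complex.exp_add, Complex.exp_add]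
    push_cast
    ring
  unfold displacementPairing
  simp only [e]
  rw [integral_const_mul, hint]
  have h1 : (Real.pi / -((-(l ^ 2 / ħ) : ℝ) : ℂ)) ^ (1 / 2 : ℂ)
      = (((Real.pi / (l ^ 2 / ħ)) ^ (1 / 2 : ℝ) : ℝ) : ℂ) := by
    rw [Complex.ofReal_cpow (by positivity)]
    push_cast
    rw [neg_neg]
  rw [h1, ← mul_assoc, ← Complex.ofReal_mul, ← Real.mul_rpow (by positivity) (by positivity)]
  have h2 : l ^ 2 / (Real.pi * ħ) * (Real.pi / (l ^ 2 / ħ)) = 1 := by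
    have := Real.pi_ne_zero
    field_simp
  rw [h2, Real.one_rpow, Complex.ofReal_one, one_mul, Complex.ofReal_exp]
  congr 1
  simp only [excitation]
  push_cast
  field_simp
  linear_combination (4 * (Ω.2 : ℂ) ^ 2) * Complex.I_sq

/-! ### The displacement operator in the number basis -/

/-- Since `a` annihilates the vacuum, each `a†` on the left only contributes a factor `α`. This
column, the row `m = 0` and the recursion below determine all matrix elements. -/
lemma displacementPairing_ladderState_zero {ħ l : ℝ} (hħ : 0 < ħ) (hl : l ≠ 0) (Ω : ℝ × ℝ) (m : ℕ) :
    displacementPairing ħ (ladderState hħ hl m) (ladderState hħ hl 0) Ω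
      = coherentAmplitude ħ l Ω ^ m * Real.exp (-excitation ħ l Ω / 2) := by
  induction m with
  | zero => simpa [ladderState] using displacementPairing_vacuum hħ hl Ω
  | succ m ih =>
    have h0 : displacementPairing ħ (ladderState hħ hl m) (0 : 𝓢(ℝ, ℂ)) Ω = 0 := by
      have h := displacementPairing_smul_right ħ 0 (ladderState hħ hl m) 0 Ω
      rwa [zero_smul, zero_mul] at h
    rw [ladderState.eq_2, displacementPairing_raising_left hħ, ih]
    rw [show ladderState hħ hl 0 = vacuum hħ hl from rfl, lowering_vacuum, h0]
    ring

lemma displacementPairing_ladderState_succ_right {ħ l : ℝ} (hħ : 0 < ħ) (hl : l ≠ 0)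
    (Ω : ℝ × ℝ) (m n : ℕ) :
    displacementPairing ħ (ladderState hħ hl (m + 1)) (ladderState hħ hl (n + 1)) Ω
      = (m + 1) * displacementPairing ħ (ladderState hħ hl m) (ladderState hħ hl n) Ω
        - starRingEnd ℂ (coherentAmplitude ħ l Ω) *
          displacementPairing ħ (ladderState hħ hl (m + 1)) (ladderState hħ hl n) Ω := by
  rw [ladderState.eq_2 hħ hl n, displacementPairing_raising_right hħ, lowering_ladderState_succ,
    displacementPairing_smul_left]

lemma displacementPairing_ladderState_zero_left_succ {ħ l : ℝ} (hħ : 0 < ħ) (hl : l ≠ 0)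
    (Ω : ℝ × ℝ) (n : ℕ) :
    displacementPairing ħ (ladderState hħ hl 0) (ladderState hħ hl (n + 1)) Ω
      = - starRingEnd ℂ (coherentAmplitude ħ l Ω) *
          displacementPairing ħ (ladderState hħ hl 0) (ladderState hħ hl n) Ω := by
  have h0 : displacementPairing ħ (0 : 𝓢(ℝ, ℂ)) (ladderState hħ hl n) Ω = 0 := by
    have h := displacementPairing_smul_left ħ 0 0 (ladderState hħ hl n) Ω
    rwa [zero_smul, zero_mul] at h
  rw [ladderState.eq_2, displacementPairing_raising_right hħ,
    show ladderState hħ hl 0 = vacuum hħ hl from rfl, lowering_vacuum, h0]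
  ring

/-- Solution of the recursion `T (m + 1) (n + 1) = (m + 1) T m n + b T (m + 1) n`,
`T 0 (n + 1) = b T 0 n`, `T m 0 = a ^ m c`. -/
lemma ladder_recursion_solution {R : Type*} [CommRing R] {a b c : R} {T : ℕ → ℕ → R}
    (h0 : ∀ m, T m 0 = a ^ m * c) (h1 : ∀ n, T 0 (n + 1) = b * T 0 n)
    (h2 : ∀ m n, T (m + 1) (n + 1) = (m + 1) * T m n + b * T (m + 1) n) (m n : ℕ) :
    T m n = c * ∑ j ∈ Finset.range (n + 1),
      (m.descFactorial j : R) * (n.choose j : R) * a ^ (m - j) * b ^ (n - j) := by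
  induction n generalizing m with
  | zero => simp [h0, mul_comm]
  | succ n ih =>
    rw [Finset.sum_range_succ']
    -- Pascal's rule splits the sum in two: the `choose (j + 1)` half with the `j = 0` term is the
    -- `b * T m n` part (`hb`), and the `choose j` half is the part with `m` lowered by one, which
    -- vanishes for `m = 0`.
    simp only [Nat.choose_succ_succ', Nat.cast_add, mul_add, add_mul, Finset.sum_add_distrib]
    have hb : ∀ m : ℕ, ∑ j ∈ Finset.range (n + 1), (m.descFactorial (j + 1) : R)
          * (n.choose (j + 1) : R) * a ^ (m - (j + 1)) * b ^ (n + 1 - (j + 1))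
        + (m.descFactorial 0 : R) * ((n + 1).choose 0 : R) * a ^ (m - 0) * b ^ (n + 1 - 0)
        = b * ∑ j ∈ Finset.range (n + 1),
          (m.descFactorial j : R) * (n.choose j : R) * a ^ (m - j) * b ^ (n - j) := by
      intro m
      rw [Finset.sum_range_succ, Nat.choose_succ_self, Finset.mul_sum, Finset.sum_range_succ']
      simp only [Nat.cast_zero, mul_zero, zero_mul, add_zero, Nat.choose_zero_right, Nat.sub_zero]
      congr 1
      · refine Finset.sum_congr rfl fun j hj ↦ ?_
        have : n + 1 - (j + 1) = n - (j + 1) + 1 := by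
          have := Finset.mem_range.mp hj
          omega
        rw [this, pow_succ]
        ring
      · rw [pow_succ]
        ring
    cases m with
    | zero =>
      rw [h1, ih, add_assoc]
      have := hb 0
      simp only [Nat.zero_descFactorial_succ, Nat.cast_zero, zero_mul, mul_zero,
        Finset.sum_const_zero, zero_add] at this ⊢
      rw [this]
      ring
    | succ m =>
      rw [h2, ih, ih, add_assoc]
      have : ∑ j ∈ Finset.range (n + 1), ((m + 1).descFactorial (j + 1) : R) * (n.choose j : R)
            * a ^ (m + 1 - (j + 1)) * b ^ (n + 1 - (j + 1))
          = (m + 1) * ∑ j ∈ Finset.range (n + 1),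
            (m.descFactorial j : R) * (n.choose j : R) * a ^ (m - j) * b ^ (n - j) := by
        rw [Finset.mul_sum]
        refine Finset.sum_congr rfl fun j _ ↦ ?_
        rw [Nat.succ_descFactorial_succ, Nat.add_sub_add_right, Nat.add_sub_add_right]
        push_cast
        ring
      linear_combination -c * this - c * hb (m + 1)

/-- The Laguerre polynomial `∑ k, (n choose k) (-s)ᵏ / k!`. -/
def laguerre (n : ℕ) (s : ℝ) : ℝ :=
  ∑ k ∈ Finset.range (n + 1), (n.choose k : ℝ) * ((-s) ^ k / k.factorial)

lemma displacementPairing_fock {ħ l : ℝ} (hħ : 0 < ħ) (hl : l ≠ 0) (Ω : ℝ × ℝ) (n : ℕ) :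
    displacementPairing ħ (fock hħ hl n) (fock hħ hl n) Ω
      = ((Real.exp (-excitation ħ l Ω / 2) * laguerre n (excitation ħ l Ω) : ℝ) : ℂ) := by
  have hT := ladder_recursion_solution (a := coherentAmplitude ħ l Ω)
    (b := -starRingEnd ℂ (coherentAmplitude ħ l Ω)) (c := (Real.exp (-excitation ħ l Ω / 2) : ℂ))
    (T := fun m n ↦ displacementPairing ħ (ladderState hħ hl m) (ladderState hħ hl n) Ω)
    (displacementPairing_ladderState_zero hħ hl Ω)
    (displacementPairing_ladderState_zero_left_succ hħ hl Ω)
    (fun m n ↦ by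
      rw [displacementPairing_ladderState_succ_right]; ring) n n
  have hf : ((√(n.factorial : ℝ) : ℝ) : ℂ)⁻¹ * ((√(n.factorial : ℝ) : ℝ) : ℂ)⁻¹
      = (n.factorial : ℂ)⁻¹ := by
    rw [← mul_inv, ← Complex.ofReal_mul, Real.mul_self_sqrt (by positivity)]
    push_cast; rfl
  rw [fock_eq_smul_ladderState, displacementPairing_smul_left, displacementPairing_smul_right, hT,
    ← mul_assoc, hf, laguerre, Complex.ofReal_mul, mul_left_comm]
  congr 1
  push_cast
  -- Reflecting `j = n - k` makes both exponents `k`, so the amplitudes combine to `(-s)ᵏ`; the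
  -- falling factorial becomes `n!/k!`, whose `n!` is removed by the normalisation.
  rw [← Finset.sum_range_reflect, Finset.mul_sum]
  refine Finset.sum_congr rfl fun k hk ↦ ?_
  have hk' : k ≤ n := by
    have := Finset.mem_range.mp hk
    omega
  have e1 : n + 1 - 1 - k = n - k := by omega
  have e2 : n - (n - k) = k := by omega
  rw [e1, e2, Nat.choose_symm hk', mul_assoc, ← mul_pow, mul_neg, coherentAmplitude_mul_conj hħ,
    Nat.descFactorial_eq_div (by omega), e2, Nat.cast_div (Nat.factorial_dvd_factorial hk')
      (by exact_mod_cast k.factorial_ne_zero)]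
  have : (n.factorial : ℂ) ≠ 0 := by exact_mod_cast n.factorial_ne_zero
  field_simp

/-- The diagonal entries as real phase-space integrals. -/
lemma parityEntry_self {ħ l : ℝ} (hħ : 0 < ħ) (hl : l ≠ 0) (n : ℕ) :
    parityEntry hħ hl n n = (((4 * Real.pi * ħ)⁻¹ * ∫ Ω : ℝ × ℝ, filterFunction ħ Ω *
      (Real.exp (-excitation ħ l Ω / 2) * laguerre n (excitation ħ l Ω)) : ℝ) : ℂ) := by
  rw [parityEntry, matrixElement, conj_fock]
  change parityPairing ħ _ _ = _
  rw [parityPairing, Complex.ofReal_mul, ← integral_complex_ofReal]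
  simp only [displacementPairing_fock, Complex.ofReal_mul]

/-! ### Gaussian phase-space averages of the filter function -/

/-- With `sinc` replaced by `cos (u y)`, the phase-space integral becomes Gaussian for each fixed
`u`. -/
lemma sinc_eq_integral_cos (y : ℝ) : Real.sinc y = ∫ u in (0 : ℝ)..1, Real.cos (u * y) := by
  rcases eq_or_ne y 0 with rfl | hy
  · simp
  · rw [intervalIntegral.integral_comp_mul_right _ hy, integral_cos, Real.sinc_of_ne_zero hy]
    simp
    field_simp

lemma integral_cos_mul_exp_neg_mul_sq {a : ℝ} (ha : 0 < a) (b : ℝ) :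
    ∫ x : ℝ, Real.cos (b * x) * Real.exp (-a * x ^ 2)
      = √(Real.pi / a) * Real.exp (-b ^ 2 / (4 * a)) := by
  have h := fourierIntegral_gaussian (b := (a : ℂ)) (by simpa using ha) (b : ℂ)
  have e : ∀ x : ℝ, Complex.exp (Complex.I * b * x) * Complex.exp (-a * x ^ 2)
      = Complex.exp ((b * x : ℝ) * Complex.I) * (Real.exp (-a * x ^ 2) : ℝ) := by
    intro x
    push_cast
    ring_nf
  simp only [e] at h
  have hi : Integrable fun x : ℝ ↦
      Complex.exp ((b * x : ℝ) * Complex.I) * (Real.exp (-a * x ^ 2) : ℝ) := by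
    refine (integrable_exp_neg_mul_sq ha).mono' (by fun_prop) (Eventually.of_forall fun x ↦ ?_)
    rw [norm_mul, Complex.norm_exp_ofReal_mul_I, one_mul, Complex.norm_real,
      Real.norm_of_nonneg (Real.exp_pos _).le]
  have h2 := congrArg Complex.re h
  rw [← RCLike.re_eq_complex_re, ← integral_re hi] at h2
  have h3 : ((Real.pi : ℂ) / a) ^ (1 / 2 : ℂ) * Complex.exp (-(b : ℂ) ^ 2 / (4 * a))
      = ((√(Real.pi / a) * Real.exp (-b ^ 2 / (4 * a)) : ℝ) : ℂ) := by
    rw [Real.sqrt_eq_rpow, Complex.ofReal_mul, Complex.ofReal_cpow (by positivity)]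
    push_cast
    rfl
  rw [h3] at h2
  simp only [RCLike.re_eq_complex_re, Complex.re_mul_ofReal, Complex.exp_ofReal_mul_I_re,
    Complex.ofReal_re] at h2
  exact h2

lemma exp_neg_mul_excitation {ħ l : ℝ} (hħ : 0 < ħ) (hl : l ≠ 0) (c : ℝ) (Ω : ℝ × ℝ) :
    Real.exp (-c * excitation ħ l Ω / 2) = Real.exp (-(c * l ^ 2 / (4 * ħ)) * Ω.1 ^ 2)
      * Real.exp (-(c / (4 * ħ * l ^ 2)) * Ω.2 ^ 2) := by
  rw [← Real.exp_add, excitation]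
  congr 1
  field_simp
  ring

lemma integrable_exp_neg_mul_excitation {ħ l c : ℝ} (hħ : 0 < ħ) (hl : l ≠ 0) (hc : 0 < c) :
    Integrable fun Ω : ℝ × ℝ ↦ Real.exp (-c * excitation ħ l Ω / 2) := by
  simp only [exp_neg_mul_excitation hħ hl]
  exact (integrable_exp_neg_mul_sq (by positivity)).mul_prod
    (integrable_exp_neg_mul_sq (by positivity))

lemma continuous_excitation (ħ l : ℝ) : Continuous (excitation ħ l) := by
  unfold excitation
  fun_prop

lemma excitation_nonneg {ħ : ℝ} (hħ : 0 < ħ) (l : ℝ) (Ω : ℝ × ℝ) : 0 ≤ excitation ħ l Ω := by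
  unfold excitation
  positivity

lemma continuous_filterFunction (ħ : ℝ) : Continuous (filterFunction ħ) := by
  unfold filterFunction
  exact Real.continuous_sinc.comp (by fun_prop)

/-- Integrating over `p` first leaves a Gaussian in `x`. Only the product of the two rates survives,
and `A * B = c² / (16 ħ²)`; this is why the entries do not depend on `l`. -/
lemma integral_cos_mul_exp_neg_mul_excitation {ħ l c : ℝ} (hħ : 0 < ħ) (hl : l ≠ 0) (hc : 0 < c)
    (u : ℝ) :
    ∫ Ω : ℝ × ℝ, Real.cos (u * (Ω.2 * Ω.1 / (2 * ħ))) * Real.exp (-c * excitation ħ l Ω / 2)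
      = 4 * Real.pi * ħ * (√(c ^ 2 + u ^ 2))⁻¹ := by
  have hi : Integrable (fun Ω : ℝ × ℝ ↦
      Real.cos (u * (Ω.2 * Ω.1 / (2 * ħ))) * Real.exp (-c * excitation ħ l Ω / 2)) := by
    refine (integrable_exp_neg_mul_excitation hħ hl hc).mono' ?_ (Eventually.of_forall fun Ω ↦ ?_)
    · have := continuous_excitation ħ l
      exact Continuous.aestronglyMeasurable (by fun_prop)
    · rw [norm_mul, Real.norm_of_nonneg (Real.exp_pos _).le]
      exact mul_le_of_le_one_left (Real.exp_pos _).le (Real.abs_cos_le_one _)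
  have hA : 0 < c * l ^ 2 / (4 * ħ) := by positivity
  have hB : 0 < c / (4 * ħ * l ^ 2) := by positivity
  set A := c * l ^ 2 / (4 * ħ) with hAdef
  set B := c / (4 * ħ * l ^ 2) with hBdef
  have e : ∀ x p : ℝ, Real.cos (u * (p * x / (2 * ħ))) * Real.exp (-c * excitation ħ l (x, p) / 2)
      = Real.exp (-A * x ^ 2) * (Real.cos (u * x / (2 * ħ) * p) * Real.exp (-B * p ^ 2)) := by
    intro x p
    rw [exp_neg_mul_excitation hħ hl, show u * (p * x / (2 * ħ)) = u * x / (2 * ħ) * p by ring]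
    ring
  have hD : 0 < A + u ^ 2 / (16 * ħ ^ 2 * B) := by positivity
  rw [Measure.volume_eq_prod, integral_prod _ hi]
  simp only [e, integral_const_mul, integral_cos_mul_exp_neg_mul_sq hB]
  have e2 : ∀ x : ℝ, Real.exp (-A * x ^ 2) *
      (√(Real.pi / B) * Real.exp (-(u * x / (2 * ħ)) ^ 2 / (4 * B)))
      = √(Real.pi / B) * Real.exp (-(A + u ^ 2 / (16 * ħ ^ 2 * B)) * x ^ 2) := by
    intro x
    rw [mul_left_comm, ← Real.exp_add]
    congr 2
    field_simp
    ring
  simp only [e2, integral_const_mul, integral_gaussian]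
  rw [← Real.sqrt_mul (by positivity)]
  have hcu : 0 < c ^ 2 + u ^ 2 := by positivity
  have e3 : Real.pi / B * (Real.pi / (A + u ^ 2 / (16 * ħ ^ 2 * B)))
      = (4 * Real.pi * ħ) ^ 2 * (c ^ 2 + u ^ 2)⁻¹ := by
    have : B * (A + u ^ 2 / (16 * ħ ^ 2 * B)) = (c ^ 2 + u ^ 2) / (16 * ħ ^ 2) := by
      rw [hAdef, hBdef]
      field_simp
      ring
    rw [div_mul_div_comm, this]
    field_simp
    ring
  rw [e3, Real.sqrt_mul (by positivity), Real.sqrt_sq (by positivity), Real.sqrt_inv]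

lemma integral_inv_sqrt_sq_add_sq {c : ℝ} (hc : 0 < c) :
    ∫ u in (0 : ℝ)..1, (√(c ^ 2 + u ^ 2))⁻¹ = Real.arsinh (1 / c) := by
  have hd : ∀ u : ℝ, HasDerivAt (fun u ↦ Real.arsinh (u / c)) (√(c ^ 2 + u ^ 2))⁻¹ u := by
    intro u
    have h := ((hasDerivAt_id u).div_const c).arsinh
    refine h.congr_deriv ?_
    have : c ^ 2 + u ^ 2 = c ^ 2 * (1 + (u / c) ^ 2) := by field_simp
    rw [this, Real.sqrt_mul (by positivity), Real.sqrt_sq hc.le, mul_inv, smul_eq_mul]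
    simp
    ring
  have hcont : Continuous fun u : ℝ ↦ (√(c ^ 2 + u ^ 2))⁻¹ :=
    Continuous.inv₀ (by fun_prop) fun u ↦ by positivity
  rw [intervalIntegral.integral_eq_sub_of_hasDerivAt (fun u _ ↦ hd u)
    (hcont.intervalIntegrable _ _)]
  simp

/-- The phase-space average of the filter function against an isotropic Gaussian. -/
lemma integral_filterFunction_mul_exp {ħ l c : ℝ} (hħ : 0 < ħ) (hl : l ≠ 0) (hc : 0 < c) :
    (4 * Real.pi * ħ)⁻¹ * ∫ Ω : ℝ × ℝ, filterFunction ħ Ω * Real.exp (-c * excitation ħ l Ω / 2)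
      = Real.arsinh (1 / c) := by
  have hint : Integrable (Function.uncurry fun (Ω : ℝ × ℝ) (u : ℝ) ↦
      Real.cos (u * (Ω.2 * Ω.1 / (2 * ħ))) * Real.exp (-c * excitation ħ l Ω / 2))
      ((volume : Measure (ℝ × ℝ)).prod (volume.restrict (Set.Ioc (0 : ℝ) 1))) := by
    have h1 := (integrable_exp_neg_mul_excitation hħ hl hc).mul_prod
      (integrable_const (1 : ℝ) (μ := volume.restrict (Set.Ioc (0 : ℝ) 1)))
    refine h1.mono' ?_ (Eventually.of_forall fun q ↦ ?_)
    · have := continuous_excitation ħ l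
      refine Continuous.aestronglyMeasurable ?_
      unfold Function.uncurry
      fun_prop
    · simp only [Function.uncurry]
      rw [norm_mul, Real.norm_of_nonneg (Real.exp_pos _).le, mul_one]
      exact mul_le_of_le_one_left (Real.exp_pos _).le (Real.abs_cos_le_one _)
  have e : ∀ Ω : ℝ × ℝ, filterFunction ħ Ω * Real.exp (-c * excitation ħ l Ω / 2)
      = ∫ u in Set.Ioc (0 : ℝ) 1,
        Real.cos (u * (Ω.2 * Ω.1 / (2 * ħ))) * Real.exp (-c * excitation ħ l Ω / 2) := by
    intro Ω
    rw [filterFunction, sinc_eq_integral_cos, intervalIntegral.integral_of_le zero_le_one,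
      integral_mul_const]
  simp only [e]
  rw [integral_integral_swap hint]
  simp only [integral_cos_mul_exp_neg_mul_excitation hħ hl hc]
  rw [integral_const_mul, ← intervalIntegral.integral_of_le zero_le_one,
    integral_inv_sqrt_sq_add_sq hc, ← mul_assoc, inv_mul_cancel₀ (by positivity), one_mul]

/-! ### Generating functions -/

/-- Used both for the Laguerre double series and for the Cauchy product with the geometric series.
-/
lemma hasSum_sum_antidiagonal {f : ℕ × ℕ → ℝ} {a : ℝ} (h : HasSum f a) :
    HasSum (fun n ↦ ∑ k ∈ Finset.range (n + 1), f (k, n - k)) a := by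
  have h1 := (Finset.HasAntidiagonal.sigmaAntidiagonalEquivProd (A := ℕ)).hasSum_iff.mpr h
  have h2 := h1.sigma fun n ↦ hasSum_fintype _
  refine h2.congr_fun fun n ↦ ?_
  rw [← Finset.Nat.sum_antidiagonal_eq_sum_range_succ_mk]
  exact (Finset.sum_coe_sort (Finset.HasAntidiagonal.antidiagonal n) f).symm

/-- The generating function of the Laguerre polynomials. -/
lemma hasSum_laguerre (s : ℝ) {t : ℝ} (ht : |t| < 1) :
    HasSum (fun n ↦ laguerre n s * t ^ n) ((1 - t)⁻¹ * Real.exp (-s * t / (1 - t))) := by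
  -- For fixed `k`, the sum over `n = j + k` is a negative binomial series. It is stated for all `s`
  -- and `t` because absolute summability of the double series applies it at `-|s|` and `|t|`.
  have key : ∀ s t : ℝ, |t| < 1 → ∀ k : ℕ, HasSum
      (fun j ↦ ((-s) ^ k / k.factorial * t ^ k) * (((j + k).choose k : ℝ) * t ^ j))
      ((1 - t)⁻¹ * ((-s * t / (1 - t)) ^ k / k.factorial)) := by
    intro s t ht k
    have h := (hasSum_choose_mul_geometric_of_norm_lt_one k
      (by rwa [Real.norm_eq_abs])).mul_left ((-s) ^ k / k.factorial * t ^ k)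
    have h0 : 1 - t ≠ 0 := by linarith [(abs_lt.mp ht).2]
    have e : (-s) ^ k / k.factorial * t ^ k * (1 / (1 - t) ^ (k + 1))
        = (1 - t)⁻¹ * ((-s * t / (1 - t)) ^ k / k.factorial) := by
      rw [div_pow, mul_pow]
      field_simp
      ring
    rwa [e] at h
  have hexp : ∀ x : ℝ, HasSum (fun k : ℕ ↦ x ^ k / k.factorial) (Real.exp x) := by
    intro x
    rw [Real.exp_eq_exp_ℝ]
    exact NormedSpace.expSeries_div_hasSum_exp x
  have habs : |(|t|)| < 1 := by rwa [abs_abs]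
  have hsum : Summable fun q : ℕ × ℕ ↦
      ((-s) ^ q.1 / q.1.factorial * t ^ q.1) * (((q.2 + q.1).choose q.1 : ℝ) * t ^ q.2) := by
    rw [← summable_abs_iff]
    have e : ∀ k j : ℕ, |((-s) ^ k / k.factorial * t ^ k) * (((j + k).choose k : ℝ) * t ^ j)|
        = ((-(-|s|)) ^ k / k.factorial * |t| ^ k) * (((j + k).choose k : ℝ) * |t| ^ j) := by
      intro k j
      simp [abs_mul, abs_div, abs_pow]
    refine (summable_prod_of_nonneg fun q ↦ abs_nonneg _).mpr ⟨fun k ↦ ?_, ?_⟩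
    · simp only [e]
      exact (key (-|s|) |t| habs k).summable
    · simp only [e, (key (-|s|) |t| habs _).tsum_eq]
      exact ((hexp _).summable.mul_left _)
  have htot := hsum.hasSum.prod_fiberwise (key s t ht)
  have hval := htot.unique ((hexp (-s * t / (1 - t))).mul_left (1 - t)⁻¹)
  rw [← hval]
  refine (hasSum_sum_antidiagonal hsum.hasSum).congr_fun fun n ↦ ?_
  rw [laguerre, Finset.sum_mul]
  refine Finset.sum_congr rfl fun k hk ↦ ?_
  have hk' : k ≤ n := by
    have := Finset.mem_range.mp hk
    omega
  simp only [Nat.sub_add_cancel hk']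
  have : t ^ n = t ^ k * t ^ (n - k) := by rw [← pow_add, Nat.add_sub_cancel' hk']
  rw [this]
  ring

/-- From `sᵏ/k! ≤ 4ᵏ exp (s/4)` and `∑ 4ᵏ (n choose k) = 5ⁿ`. Geometric growth in `n` is harmless,
since the generating function is needed only near `t = 0`, and the remaining `exp (-s/4)` is
integrable. -/
lemma abs_exp_mul_laguerre_le {s : ℝ} (hs : 0 ≤ s) (n : ℕ) :
    |Real.exp (-s / 2) * laguerre n s| ≤ 5 ^ n * Real.exp (-s / 4) := by
  have h : |laguerre n s| ≤ 5 ^ n * Real.exp (s / 4) := by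
    have h5 : (5 : ℝ) ^ n = ∑ k ∈ Finset.range (n + 1), (4 : ℝ) ^ k * n.choose k := by
      rw [show (5 : ℝ) = 4 + 1 by norm_num, add_pow]
      simp
    rw [laguerre, h5, Finset.sum_mul]
    refine (Finset.abs_sum_le_sum_abs _ _).trans (Finset.sum_le_sum fun k _ ↦ ?_)
    have := Real.pow_div_factorial_le_exp (s / 4) (by positivity) k
    rw [abs_mul, abs_div, abs_pow, abs_neg, abs_of_nonneg hs, Nat.abs_cast, Nat.abs_cast]
    calc (n.choose k : ℝ) * (s ^ k / k.factorial)
        = 4 ^ k * n.choose k * ((s / 4) ^ k / k.factorial) := by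
          rw [div_pow]; field_simp
      _ ≤ _ := by gcongr
  rw [abs_mul, abs_of_pos (Real.exp_pos _)]
  calc Real.exp (-s / 2) * |laguerre n s| ≤ Real.exp (-s / 2) * (5 ^ n * Real.exp (s / 4)) := by
        gcongr
    _ = 5 ^ n * (Real.exp (-s / 2) * Real.exp (s / 4)) := by ring
    _ = _ := by rw [← Real.exp_add]; ring_nf

lemma continuous_laguerre (n : ℕ) : Continuous (laguerre n) := by
  unfold laguerre
  fun_prop

/-- The real value of the diagonal entry `⟨n| Π |n⟩`. -/
def diagonalEntry (ħ l : ℝ) (n : ℕ) : ℝ :=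
  (4 * Real.pi * ħ)⁻¹ * ∫ Ω : ℝ × ℝ, filterFunction ħ Ω *
    (Real.exp (-excitation ħ l Ω / 2) * laguerre n (excitation ħ l Ω))

/-- The generating function of the diagonal entries. -/
lemma hasSum_diagonalEntry {ħ l t : ℝ} (hħ : 0 < ħ) (hl : l ≠ 0) (ht : |t| < 1 / 5) :
    HasSum (fun n ↦ diagonalEntry ħ l n * t ^ n)
      (Real.arsinh ((1 - t) / (1 + t)) * (1 - t)⁻¹) := by
  obtain ⟨ht1, ht2⟩ := abs_lt.mp ht
  -- This is the rate `c` obtained from `1/2 + t/(1 - t) = c/2`, the total exponent of the Gaussian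
  -- times the Laguerre generating function.
  have hc : 0 < (1 + t) / (1 - t) := div_pos (by linarith) (by linarith)
  have hgeom : HasSum (fun n : ℕ ↦ (5 * |t|) ^ n) (1 - 5 * |t|)⁻¹ :=
    hasSum_geometric_of_lt_one (by positivity) (by linarith)
  have hexp := integrable_exp_neg_mul_excitation hħ hl (c := 1 / 2) (by norm_num)
  have e4 : ∀ Ω, Real.exp (-(1 / 2) * excitation ħ l Ω / 2) = Real.exp (-excitation ħ l Ω / 4) := by
    intro Ω; congr 1; ring
  simp only [e4] at hexp
  have h := hasSum_integral_of_dominated_convergence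
    (μ := (volume : Measure (ℝ × ℝ)))
    (F := fun n Ω ↦ filterFunction ħ Ω *
      (Real.exp (-excitation ħ l Ω / 2) * laguerre n (excitation ħ l Ω)) * t ^ n)
    (f := fun Ω ↦ (1 - t)⁻¹ *
      (filterFunction ħ Ω * Real.exp (-((1 + t) / (1 - t)) * excitation ħ l Ω / 2)))
    (fun n Ω ↦ (5 * |t|) ^ n * Real.exp (-excitation ħ l Ω / 4))
    (fun n ↦ by
      have h1 := continuous_excitation ħ l
      have h2 := continuous_filterFunction ħ
      have h3 := continuous_laguerre n
      exact Continuous.aestronglyMeasurable (by fun_prop))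
    (fun n ↦ Eventually.of_forall fun Ω ↦ by
      have h1 := abs_exp_mul_laguerre_le (excitation_nonneg hħ l Ω) n
      have h2 := abs_filter_le_one ħ Ω
      rw [Real.norm_eq_abs, abs_mul, abs_mul, abs_pow, mul_pow, mul_right_comm (5 ^ n)]
      refine mul_le_mul_of_nonneg_right ?_ (by positivity)
      exact (mul_le_of_le_one_left (abs_nonneg _) h2).trans h1)
    (Eventually.of_forall fun Ω ↦ hgeom.summable.mul_right _)
    (by
      simp only [tsum_mul_right]
      exact hexp.const_mul _)
    (Eventually.of_forall fun Ω ↦ by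
      have h1 := (hasSum_laguerre (excitation ħ l Ω) (t := t) (by linarith)).mul_left
        (filterFunction ħ Ω * Real.exp (-excitation ħ l Ω / 2))
      have h2 : filterFunction ħ Ω * Real.exp (-excitation ħ l Ω / 2) *
          ((1 - t)⁻¹ * Real.exp (-excitation ħ l Ω * t / (1 - t)))
          = (1 - t)⁻¹ *
            (filterFunction ħ Ω * Real.exp (-((1 + t) / (1 - t)) * excitation ħ l Ω / 2)) := by
        have h3 : -((1 + t) / (1 - t)) * excitation ħ l Ω / 2
            = -excitation ħ l Ω / 2 + -excitation ħ l Ω * t / (1 - t) := by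
          have : 1 - t ≠ 0 := by linarith
          field_simp
          ring
        rw [h3, Real.exp_add]
        ring
      rw [h2] at h1
      refine h1.congr_fun fun n ↦ ?_
      ring)
  have h' := h.mul_left (4 * Real.pi * ħ)⁻¹
  rw [integral_const_mul, mul_left_comm, integral_filterFunction_mul_exp hħ hl hc, one_div_div] at h'
  rw [mul_comm]
  refine h'.congr_fun fun n ↦ ?_
  rw [diagonalEntry, integral_mul_const, mul_assoc]

/-! ### Power series -/

lemma hasFPowerSeriesAt_of_hasSum {a : ℕ → ℝ} {f : ℝ → ℝ} {r : ℝ} (hr : 0 < r)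
    (h : ∀ t : ℝ, |t| < r → HasSum (fun n ↦ a n * t ^ n) (f t)) :
    HasFPowerSeriesAt f (FormalMultilinearSeries.ofScalars ℝ a) 0 := by
  -- Nothing is assumed at `|t| = r`, so the radius is bounded below through the interior point `r /
  -- 2`.
  have hr2 : 0 < r / 2 := by positivity
  refine ⟨ENNReal.ofReal (r / 2), ?_, ENNReal.ofReal_pos.mpr hr2, fun {y} hy ↦ ?_⟩
  · refine FormalMultilinearSeries.le_radius_of_summable _ (r := (r / 2).toNNReal) ?_
    have hs := (h (r / 2) (by rw [abs_of_pos hr2]; linarith)).summable.norm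
    refine hs.congr fun n ↦ ?_
    rw [FormalMultilinearSeries.ofScalars_norm, Real.coe_toNNReal _ hr2.le, norm_mul, norm_pow,
      Real.norm_of_nonneg hr2.le]
  · rw [Metric.eball_ofReal, mem_ball_zero_iff, Real.norm_eq_abs] at hy
    simp only [FormalMultilinearSeries.ofScalars_apply_eq, zero_add, smul_eq_mul]
    exact h y (by linarith)

lemma eq_of_hasSum_mul_pow {a b : ℕ → ℝ} {f : ℝ → ℝ} {r : ℝ} (hr : 0 < r)
    (ha : ∀ t : ℝ, |t| < r → HasSum (fun n ↦ a n * t ^ n) (f t))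
    (hb : ∀ t : ℝ, |t| < r → HasSum (fun n ↦ b n * t ^ n) (f t)) : a = b :=
  FormalMultilinearSeries.ofScalars_series_injective ℝ ℝ
    ((hasFPowerSeriesAt_of_hasSum hr ha).eq_formalMultilinearSeries
      (hasFPowerSeriesAt_of_hasSum hr hb))

/-- Division by `1 - t` turns coefficients into partial sums. -/
lemma hasSum_partialSum_mul_pow {a : ℕ → ℝ} {t S : ℝ} (ht : |t| < 1)
    (ha : HasSum (fun n ↦ a n * t ^ n) S) :
    HasSum (fun n ↦ (∑ k ∈ Finset.range (n + 1), a k) * t ^ n) (S * (1 - t)⁻¹) := by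
  have hg := hasSum_geometric_of_abs_lt_one ht
  have hs := summable_mul_of_summable_norm ha.summable.norm hg.summable.norm
  have h := hasSum_sum_antidiagonal (ha.mul hg hs)
  refine h.congr_fun fun n ↦ ?_
  rw [Finset.sum_mul]
  refine Finset.sum_congr rfl fun k hk ↦ ?_
  have hk' : k ≤ n := by
    have := Finset.mem_range.mp hk
    omega
  rw [mul_assoc, ← pow_add, Nat.add_sub_cancel' hk']

/-! ### The series of `arsinh ((1 - t) / (1 + t))` -/

/-- Both sides are multiplied by `(-1/2 - n)/(n + 1)` when `n` increases by one. -/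
lemma choose_neg_half (n : ℕ) :
    Ring.choose (-1 / 2 : ℝ) n = (Nat.choose (2 * n) n : ℝ) * (-1 / 4 : ℝ) ^ n := by
  induction n with
  | zero => simp
  | succ n ih =>
    have h1 : ((n : ℝ) + 1) * Ring.choose (-1 / 2 : ℝ) (n + 1)
        = (-1 / 2 - n) * Ring.choose (-1 / 2 : ℝ) n := by
      rw [Ring.choose_eq_smul, Ring.choose_eq_smul, descPochhammer_succ_right,
        Polynomial.smeval_mul, Nat.factorial_succ]
      have : (n.factorial : ℝ) ≠ 0 := by exact_mod_cast n.factorial_ne_zero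
      simp [Polynomial.smeval_sub, Polynomial.smeval_X, Polynomial.smeval_natCast]
      field_simp
    have h2 : ((n : ℝ) + 1) * ((2 * (n + 1)).choose (n + 1) : ℝ)
        = 2 * (2 * n + 1) * ((2 * n).choose n : ℝ) := by
      have := Nat.succ_mul_centralBinom_succ n
      rw [Nat.centralBinom, Nat.centralBinom] at this
      exact_mod_cast this
    have h3 : (n : ℝ) + 1 ≠ 0 := by positivity
    apply mul_left_cancel₀ h3
    rw [h1, ih, pow_succ]
    linear_combination (1 / 4) * (-1 / 4 : ℝ) ^ n * h2

lemma hasSum_inv_sqrt_one_add {x : ℝ} (hx : |x| < 1) :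
    HasSum (fun m : ℕ ↦ (Nat.choose (2 * m) m : ℝ) * (-1 / 4 : ℝ) ^ m * x ^ m)
      (√(1 + x))⁻¹ := by
  have h := (Real.one_add_rpow_hasFPowerSeriesOnBall_zero (a := -1 / 2)).hasSum (y := x)
    (by simpa [Metric.mem_eball, edist_dist, Real.dist_eq] using hx)
  have hpos : 0 ≤ 1 + x := by linarith [(abs_lt.mp hx).1]
  have e : (1 + (0 + x)) ^ (-1 / 2 : ℝ) = (√(1 + x))⁻¹ := by
    rw [zero_add, neg_div, Real.rpow_neg hpos, Real.sqrt_eq_rpow]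
  rw [e] at h
  refine h.congr_fun fun m ↦ ?_
  rw [binomialSeries_apply, choose_neg_half]
  simp

/-- The partial sums of the binomial series of `(1 + x)^(-1/2)` at `x = 1`. -/
def binomialPartialSum (j : ℕ) : ℝ :=
  ∑ m ∈ Finset.range (j + 1), (Nat.choose (2 * m) m : ℝ) * (-1 / 4 : ℝ) ^ m

/-- Write `1/(1 + t) = (1 - t)/(1 - t²)`. In `x = t²`, the factor `1/(1 - x)` gives the partial sums
of the binomial series at even powers; the factor `1 - t` repeats them with opposite sign at odd
powers. Hence the index `k / 2` and the sign `(-1) ^ k`. -/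
lemma hasSum_inv_one_add_mul_inv_sqrt {t : ℝ} (ht : |t| < 1) :
    HasSum (fun k : ℕ ↦ (-1) ^ k * binomialPartialSum (k / 2) * t ^ k)
      ((1 + t)⁻¹ * (√(1 + t ^ 2))⁻¹) := by
  have ht2 : |t ^ 2| < 1 := by
    rw [abs_pow]
    exact pow_lt_one₀ (abs_nonneg _) ht two_ne_zero
  have h := hasSum_partialSum_mul_pow ht2 (hasSum_inv_sqrt_one_add ht2)
  obtain ⟨h1, h2⟩ := abs_lt.mp ht
  have he : HasSum (fun j : ℕ ↦ (-1) ^ (2 * j) * binomialPartialSum (2 * j / 2) * t ^ (2 * j))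
      ((√(1 + t ^ 2))⁻¹ * (1 - t ^ 2)⁻¹) := by
    refine h.congr_fun fun j ↦ ?_
    rw [pow_mul t, pow_mul, binomialPartialSum, Nat.mul_div_cancel_left j two_pos]
    simp
  have ho : HasSum (fun j : ℕ ↦ (-1) ^ (2 * j + 1) * binomialPartialSum ((2 * j + 1) / 2)
      * t ^ (2 * j + 1)) (-t * ((√(1 + t ^ 2))⁻¹ * (1 - t ^ 2)⁻¹)) := by
    refine (h.mul_left (-t)).congr_fun fun j ↦ ?_
    rw [pow_succ t, pow_succ (-1 : ℝ), pow_mul t, pow_mul, binomialPartialSum,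
      show (2 * j + 1) / 2 = j by omega]
    simp
    ring
  have h5 := HasSum.even_add_odd
    (f := fun k : ℕ ↦ (-1) ^ k * binomialPartialSum (k / 2) * t ^ k) he ho
  have h3 : 1 + t ≠ 0 := by linarith
  have h4 : 1 - t ≠ 0 := by linarith
  have e : (√(1 + t ^ 2))⁻¹ * (1 - t ^ 2)⁻¹ + -t * ((√(1 + t ^ 2))⁻¹ * (1 - t ^ 2)⁻¹)
      = (1 + t)⁻¹ * (√(1 + t ^ 2))⁻¹ := by
    rw [show 1 - t ^ 2 = (1 + t) * (1 - t) by ring, mul_inv]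
    field_simp
    ring
  rwa [e] at h5

/-- The range includes `t = 1`, beyond the disc of the power series; continuity there feeds the Abel
argument. -/
lemma hasDerivAt_arsinh_cayley {t : ℝ} (ht : -1 < t) :
    HasDerivAt (fun t ↦ Real.arsinh ((1 - t) / (1 + t)))
      (-√2 * ((1 + t)⁻¹ * (√(1 + t ^ 2))⁻¹)) t := by
  have h0 : 0 < 1 + t := by linarith
  have h1 : HasDerivAt (fun t : ℝ ↦ (1 - t) / (1 + t)) _ t :=
    ((hasDerivAt_id t).const_sub 1).div ((hasDerivAt_id t).const_add 1) h0.ne'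
  refine h1.arsinh.congr_deriv ?_
  have e : 1 + ((1 - t) / (1 + t)) ^ 2 = 2 * (1 + t ^ 2) / (1 + t) ^ 2 := by
    field_simp
    ring
  have h2 : 0 < √(1 + t ^ 2) := by positivity
  have h3 : √2 * √2 = 2 := Real.mul_self_sqrt (by norm_num)
  simp only [id_eq]
  rw [e, Real.sqrt_div (by positivity), Real.sqrt_sq h0.le, Real.sqrt_mul (by norm_num), smul_eq_mul]
  field_simp
  linear_combination h3

/-- The Taylor coefficients of `arsinh ((1 - t) / (1 + t))` at `0`. -/
def arsinhCoeff : ℕ → ℝ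
  | 0 => Real.arsinh 1
  | k + 1 => -√2 * ((-1) ^ k / ((k : ℝ) + 1) * binomialPartialSum (k / 2))

lemma hasSum_arsinhCoeff {t : ℝ} (ht : |t| < 1) :
    HasSum (fun n ↦ arsinhCoeff n * t ^ n) (Real.arsinh ((1 - t) / (1 + t))) := by
  have habs : |(|t|)| < 1 := by rwa [abs_abs]
  have hle : ∀ u ∈ Set.uIcc 0 t, |u| ≤ |t| := fun u hu ↦ by
    simpa using Set.abs_sub_left_of_mem_uIcc hu
  have hs := (hasSum_inv_one_add_mul_inv_sqrt habs).summable.norm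
  -- Termwise integration from `0` to `t`, dominated by the absolutely convergent series at `|t|`.
  have hint := intervalIntegral.hasSum_integral_of_dominated_convergence
    (μ := volume) (a := 0) (b := t)
    (F := fun (k : ℕ) u ↦ (-1) ^ k * binomialPartialSum (k / 2) * u ^ k)
    (f := fun u ↦ (1 + u)⁻¹ * (√(1 + u ^ 2))⁻¹)
    (fun k _ ↦ ‖(-1) ^ k * binomialPartialSum (k / 2) * |t| ^ k‖)
    (fun k ↦ Continuous.aestronglyMeasurable (by fun_prop))
    (fun k ↦ Eventually.of_forall fun u hu ↦ by
      have := hle u (Set.uIoc_subset_uIcc hu)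
      rw [norm_mul, norm_mul _ (|t| ^ k), norm_pow, norm_pow, Real.norm_eq_abs u,
        Real.norm_eq_abs |t|, abs_abs]
      gcongr)
    (Eventually.of_forall fun u _ ↦ hs)
    intervalIntegrable_const
    (Eventually.of_forall fun u hu ↦
      hasSum_inv_one_add_mul_inv_sqrt ((hle u (Set.uIoc_subset_uIcc hu)).trans_lt ht))
  have hgt : ∀ u ∈ Set.uIcc 0 t, -1 < u := fun u hu ↦
    (abs_lt.mp ((hle u hu).trans_lt ht)).1
  have hftc := intervalIntegral.integral_eq_sub_of_hasDerivAt
    (fun u hu ↦ hasDerivAt_arsinh_cayley (hgt u hu))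
    (ContinuousOn.intervalIntegrable (by
      refine continuousOn_const.mul (ContinuousOn.mul ?_ ?_)
      · exact ContinuousOn.inv₀ (by fun_prop) fun u hu ↦ by linarith [hgt u hu]
      · exact ContinuousOn.inv₀ (by fun_prop) fun u _ ↦ by positivity))
  rw [intervalIntegral.integral_const_mul] at hftc
  have h := hint.mul_left (-√2)
  rw [hftc] at h
  have h1 : HasSum (fun k : ℕ ↦ arsinhCoeff (k + 1) * t ^ (k + 1))
      (Real.arsinh ((1 - t) / (1 + t)) - Real.arsinh 1) := by
    simp only [sub_zero, add_zero, div_one] at h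
    refine h.congr_fun fun k ↦ ?_
    rw [intervalIntegral.integral_const_mul, integral_pow, arsinhCoeff]
    simp
    ring
  have h2 := (hasSum_nat_add_iff' (f := fun n ↦ arsinhCoeff n * t ^ n) 1
    (g := Real.arsinh ((1 - t) / (1 + t)))).mp
  refine h2 ?_
  simpa [arsinhCoeff] using h1

lemma sum_arsinhCoeff (n : ℕ) :
    ∑ k ∈ Finset.range (n + 1), arsinhCoeff k = Real.arsinh 1 -
      √2 * ∑ k ∈ Finset.range n, (-1 : ℝ) ^ k / ((k : ℝ) + 1) * binomialPartialSum (k / 2) := by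
  rw [Finset.sum_range_succ', Finset.mul_sum]
  simp only [arsinhCoeff, neg_mul, Finset.sum_neg_distrib]
  ring

/-! ### Convergence at `t = 1` -/

/-- Peel off the first term: the sum is `c 0` minus the alternating sum of the shifted sequence,
which lies in `[0, c 1]` by induction. -/
lemma alternating_sum_mem_Icc {c : ℕ → ℝ} (hc : Antitone c) (h0 : ∀ n, 0 ≤ c n) (j : ℕ) :
    ∑ m ∈ Finset.range (j + 1), (-1) ^ m * c m ∈ Set.Icc 0 (c 0) := by
  induction j generalizing c with
  | zero => simpa using h0 0
  | succ j ih =>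
    obtain ⟨h1, h2⟩ := ih (c := fun n ↦ c (n + 1)) (fun a b h ↦ hc (by omega)) fun n ↦ h0 _
    have h3 : c 1 ≤ c 0 := hc zero_le_one
    rw [Finset.sum_range_succ']
    have e : ∑ m ∈ Finset.range (j + 1), (-1) ^ (m + 1) * c (m + 1)
        = -∑ m ∈ Finset.range (j + 1), (-1) ^ m * c (m + 1) := by
      rw [← Finset.sum_neg_distrib]
      exact Finset.sum_congr rfl fun m _ ↦ by ring
    rw [e]
    simp only [zero_add] at h2
    constructor
    · simp only [pow_zero, one_mul]; linarith
    · simp only [pow_zero, one_mul]; linarith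

lemma abs_binomialPartialSum_le_one (j : ℕ) : |binomialPartialSum j| ≤ 1 := by
  have hanti : Antitone fun m : ℕ ↦ (Nat.choose (2 * m) m : ℝ) * (1 / 4 : ℝ) ^ m := by
    refine antitone_nat_of_succ_le fun n ↦ ?_
    have h2 : ((n : ℝ) + 1) * ((2 * (n + 1)).choose (n + 1) : ℝ)
        = 2 * (2 * n + 1) * ((2 * n).choose n : ℝ) := by
      have := Nat.succ_mul_centralBinom_succ n
      rw [Nat.centralBinom, Nat.centralBinom] at this
      exact_mod_cast this
    have h3 : ((2 * (n + 1)).choose (n + 1) : ℝ) ≤ 4 * ((2 * n).choose n : ℝ) := by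
      have : (0 : ℝ) < (n : ℝ) + 1 := by positivity
      refine le_of_mul_le_mul_left ?_ this
      rw [h2]
      have : (0 : ℝ) ≤ ((2 * n).choose n : ℝ) := by positivity
      linarith
    calc ((2 * (n + 1)).choose (n + 1) : ℝ) * (1 / 4 : ℝ) ^ (n + 1)
        ≤ 4 * ((2 * n).choose n : ℝ) * (1 / 4 : ℝ) ^ (n + 1) := by gcongr
      _ = _ := by rw [pow_succ]; ring
  obtain ⟨h1, h2⟩ := alternating_sum_mem_Icc hanti (fun n ↦ by positivity) j
  have e : binomialPartialSum j = ∑ m ∈ Finset.range (j + 1),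
      (-1) ^ m * ((Nat.choose (2 * m) m : ℝ) * (1 / 4 : ℝ) ^ m) := by
    refine Finset.sum_congr rfl fun m _ ↦ ?_
    rw [show (-1 / 4 : ℝ) = -1 * (1 / 4) by norm_num, mul_pow]
    ring
  rw [e, abs_of_nonneg h1]
  simpa using h2

/-- Dirichlet's test against `1/(k + 1)`. The terms `k = 2j` and `k = 2j + 1` carry the same partial
sum with opposite signs and cancel, so the sums in `hb` are either zero or a single term bounded by
`1`. -/
lemma exists_tendsto_sum_arsinhCoeff :
    ∃ L, Tendsto (fun n ↦ ∑ k ∈ Finset.range n, arsinhCoeff k) atTop (𝓝 L) := by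
  have hb : ∀ n, ‖∑ k ∈ Finset.range n, (-1 : ℝ) ^ k * binomialPartialSum (k / 2)‖ ≤ 1 := by
    intro n
    have heven : ∀ j, ∑ k ∈ Finset.range (2 * j), (-1 : ℝ) ^ k * binomialPartialSum (k / 2) = 0 := by
      intro j
      induction j with
      | zero => simp
      | succ j ih =>
        rw [mul_add, mul_one, Finset.sum_range_succ, Finset.sum_range_succ, ih,
          show (2 * j + 1) / 2 = j by omega, show 2 * j / 2 = j by omega, pow_succ]
        ring
    rcases Nat.even_or_odd' n with ⟨j, rfl | rfl⟩
    · rw [heven]; simp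
    · rw [Finset.sum_range_succ, heven, zero_add, norm_mul, norm_pow, norm_neg, norm_one, one_pow,
        one_mul]
      exact abs_binomialPartialSum_le_one _
  have hanti : Antitone fun k : ℕ ↦ 1 / ((k : ℝ) + 1) := fun a b h ↦ by
    dsimp only
    gcongr
  obtain ⟨L, hL⟩ := cauchySeq_tendsto_of_complete
    (hanti.cauchySeq_series_mul_of_tendsto_zero_of_bounded tendsto_one_div_add_atTop_nhds_zero_nat hb)
  refine ⟨Real.arsinh 1 - √2 * L, (tendsto_add_atTop_iff_nat 1).mp ?_⟩
  simp only [sum_arsinhCoeff]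
  refine (tendsto_const_nhds.sub (hL.const_mul _)).congr fun n ↦ ?_
  congr 2
  refine Finset.sum_congr rfl fun k _ ↦ ?_
  rw [smul_eq_mul]
  ring

/-- Convergence is already known, so Abel's limit theorem evaluates the sum as the limit of `arsinh
((1 - t)/(1 + t))` for `t → 1⁻`. -/
lemma tendsto_sum_arsinhCoeff :
    Tendsto (fun n ↦ ∑ k ∈ Finset.range n, arsinhCoeff k) atTop (𝓝 0) := by
  obtain ⟨L, hL⟩ := exists_tendsto_sum_arsinhCoeff
  have h1 := Real.tendsto_tsum_powerSeries_nhdsWithin_lt hL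
  have h2 : Tendsto (fun t : ℝ ↦ Real.arsinh ((1 - t) / (1 + t))) (𝓝[<] 1) (𝓝 0) := by
    have h := (hasDerivAt_arsinh_cayley (t := 1) (by norm_num)).continuousAt.tendsto
    simp only [sub_self, zero_div, Real.arsinh_zero] at h
    exact h.mono_left nhdsWithin_le_nhds
  have h3 : (fun t : ℝ ↦ ∑' n, arsinhCoeff n * t ^ n)
      =ᶠ[𝓝[<] 1] fun t ↦ Real.arsinh ((1 - t) / (1 + t)) := by
    filter_upwards [Ioo_mem_nhdsLT (show (-1 : ℝ) < 1 by norm_num)] with t ht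
    exact (hasSum_arsinhCoeff (abs_lt.mpr ht)).tsum_eq
  rwa [tendsto_nhds_unique h1 (h2.congr' h3.symm)] at hL

/-! ### Comparison of coefficients and the main theorem -/

lemma diagonalEntry_eq_sum {ħ l : ℝ} (hħ : 0 < ħ) (hl : l ≠ 0) (n : ℕ) :
    diagonalEntry ħ l n = ∑ k ∈ Finset.range (n + 1), arsinhCoeff k := by
  -- The radius `1/5` is the one on which the bound `5ⁿ` permits the exchange of sum and integral.
  have h := eq_of_hasSum_mul_pow (r := 1 / 5) (by norm_num)
    (fun t ht ↦ hasSum_diagonalEntry hħ hl ht)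
    (fun t ht ↦ hasSum_partialSum_mul_pow (by linarith) (hasSum_arsinhCoeff (by linarith)))
  exact congrFun h n

end BornJordan

end

theorem mainTheorem8 (ħ l : ℝ) (hħ : 0 < ħ) (hl : l ≠ 0) :
    (∀ n : ℕ, BornJordan.parityEntry hħ hl n n =
      ((Real.arsinh 1 - √2 * ∑ k ∈ Finset.range n, (-1 : ℝ) ^ k / ((k : ℝ) + 1) *
          ∑ m ∈ Finset.range (k / 2 + 1), (Nat.choose (2 * m) m : ℝ) * (-1 / 4 : ℝ) ^ m : ℝ) : ℂ)) ∧
    Tendsto (fun n : ℕ ↦ BornJordan.parityEntry hħ hl n n) atTop (𝓝 0) := by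
  have h : ∀ n, BornJordan.parityEntry hħ hl n n
      = ((∑ k ∈ Finset.range (n + 1), BornJordan.arsinhCoeff k : ℝ) : ℂ) := fun n ↦ by
    rw [BornJordan.parityEntry_self, ← BornJordan.diagonalEntry_eq_sum hħ hl n]
    rfl
  refine ⟨fun n ↦ ?_, ?_⟩
  · rw [h, BornJordan.sum_arsinhCoeff]
    rfl
  · simp only [h]
    have h0 := (tendsto_add_atTop_iff_nat 1).mpr BornJordan.tendsto_sum_arsinhCoeff
    simpa [Function.comp_def] using (Complex.continuous_ofReal.tendsto 0).comp h0
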